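/- Let $n\ge 6$ and $k=3$. Let $B=B_{3,n}$ be the completion, with respect to the two-sided ideal generated by the arrows, of the path algebra over $\mathbb C$ of the quiver with vertex set $\mathbb Z/n$ and arrows $x_i\colon i-1\to i$, $y_i\colon i\to i-1$ ($i\in\mathbb Z/n$), modulo the $2n$ relations $xy=yx$ and $x^3=y^{n-3}$ starting at every vertex (indices suppressed). It is an algebra over $Z=\mathbb C[[t]]$, where $t$ acts as the central element $\sum_i x_iy_i$. For a rim $I$, i.e. a $3$-element subset $I\subset\mathbb Z/n$, let $L_I$ be the left $B$-module with $U_i=\mathbb C[[t]]$ at every vertex $i$, where $x_i\colon U_{i-1}\to U_i$ is multiplication by $1$ if $i\in I$ and by $t$ if $i\notin I$, and $y_i\colon U_i\to U_{i-1}$ is multiplication by $t$ if $i\in I$ and by $1$ if $i\notin I$. Two rims $I,J$ are *crossing* if there are cyclically ordered $a,b,c,d\in\mathbb Z/n$ with $a,c\in I\setminus J$ and $b,d\in J\setminus I$. They are *$r$-interlacing* if there are $i_1,i_3,\dots,i_{2r-1}\in I\setminus J$ and $i_2,i_4,\dots,i_{2r}\in J\setminus I$ with $i_1<i_2<\dots<i_{2r}<i_1$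 in the cyclic order, and there are no larger subsets with this property. Let $I$ and $J$ be rims, and write $\mathbb C=\mathbb C[[t]]/(t)$ for the one-dimensional $Z$-module on which $t$ acts as $0$. 1. $\operatorname{Ext}^1_B(L_I,L_J)\cong\mathbb C\times\mathbb C$ if and only if $I$ and $J$ are $3$-interlacing. 2. If $I$ and $J$ are crossing but not $3$-interlacing, then $\operatorname{Ext}^1_B(L_I,L_J)\cong\mathbb C$. In both parts, the assertion holds both for isomorphisms of complex vector spaces and for isomorphisms of $Z$-modules. -/

import Mathlib

open CategoryTheory
open scoped PowerSeries ModuleCat.Algebra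

noncomputable section

namespace BoundaryAlgebra

/-- Generators of the path algebra of the doubled circular quiver with vertex set `ZMod n`:
the trivial paths `e i`, and for every edge `i` (which joins `i - 1` and `i`) the arrows
`x i : i - 1 → i` and `y i : i → i - 1`. -/
inductive Gen (n : ℕ) : Type
  | e (i : ZMod n) : Gen n
  | x (i : ZMod n) : Gen n
  | y (i : ZMod n) : Gen n

variable {k n : ℕ} [NeZero n]

/-- The free generator `e i`. -/
abbrev fe (i : ZMod n) : FreeAlgebra ℂ (Gen n) := FreeAlgebra.ι ℂ (Gen.e i)

/-- The free generator `x i`. -/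
abbrev fx (i : ZMod n) : FreeAlgebra ℂ (Gen n) := FreeAlgebra.ι ℂ (Gen.x i)

/-- The free generator `y i`. -/
abbrev fy (i : ZMod n) : FreeAlgebra ℂ (Gen n) := FreeAlgebra.ι ℂ (Gen.y i)

/-- The relations. The first seven families define the path algebra (paths are composed like maps,
so that representations of the quiver are left modules); the last two are the relations
`xy = yx` and `x ^ k = y ^ (n - k)`, starting at any vertex `i`. -/
inductive Rel (k n : ℕ) [NeZero n] : FreeAlgebra ℂ (Gen n) → FreeAlgebra ℂ (Gen n) → Prop
  | e_mul_e (i : ZMod n) : Rel k n (fe i * fe i) (fe i)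
  | e_mul_e_of_ne (i j : ZMod n) (h : i ≠ j) : Rel k n (fe i * fe j) 0
  | sum_e : Rel k n (∑ i, fe i) 1
  | e_mul_x (i : ZMod n) : Rel k n (fe i * fx i) (fx i)
  | x_mul_e (i : ZMod n) : Rel k n (fx i * fe (i - 1)) (fx i)
  | e_mul_y (i : ZMod n) : Rel k n (fe (i - 1) * fy i) (fy i)
  | y_mul_e (i : ZMod n) : Rel k n (fy i * fe i) (fy i)
  | comm (i : ZMod n) : Rel k n (fx i * fy i) (fy (i + 1) * fx (i + 1))
  | pow (i : ZMod n) : Rel k n ((∑ j, fx j) ^ k * fe i) ((∑ j, fy j) ^ (n - k) * fe i)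

variable (k n) in
/-- The path algebra over `ℂ` of the doubled circular quiver modulo the relations `xy = yx` and
`x ^ k = y ^ (n - k)`, before completion. -/
def Alg : Type := RingQuot (Rel k n)

namespace Alg

instance : Ring (Alg k n) := inferInstanceAs (Ring (RingQuot (Rel k n)))

instance : Algebra ℂ (Alg k n) := inferInstanceAs (Algebra ℂ (RingQuot (Rel k n)))

variable (k n) in
/-- The quotient map. -/
def mk : FreeAlgebra ℂ (Gen n) →ₐ[ℂ] Alg k n := RingQuot.mkAlgHom ℂ (Rel k n)

lemma mk_rel {a b : FreeAlgebra ℂ (Gen n)} (h : Rel k n a b) : mk k n a = mk k n b :=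
  RingQuot.mkAlgHom_rel ℂ h

lemma mk_surjective : Function.Surjective (mk k n) := RingQuot.mkAlgHom_surjective ℂ (Rel k n)

variable {S : Type} [Semiring S] [Algebra ℂ S] in
/-- The universal property of the quotient. -/
def lift (f : FreeAlgebra ℂ (Gen n) →ₐ[ℂ] S) (h : ∀ ⦃a b⦄, Rel k n a b → f a = f b) :
    Alg k n →ₐ[ℂ] S := RingQuot.liftAlgHom ℂ ⟨f, h⟩

variable {S : Type} [Semiring S] [Algebra ℂ S] in
lemma lift_mk (f : FreeAlgebra ℂ (Gen n) →ₐ[ℂ] S) (h : ∀ ⦃a b⦄, Rel k n a b → f a = f b)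
    (a : FreeAlgebra ℂ (Gen n)) : lift f h (mk k n a) = f a :=
  RingQuot.liftAlgHom_mkAlgHom_apply ℂ f h a

variable (k) in
/-- The trivial path at the vertex `i`. -/
def e (i : ZMod n) : Alg k n := mk k n (fe i)

variable (k) in
/-- The arrow `x i : i - 1 → i`. -/
def x (i : ZMod n) : Alg k n := mk k n (fx i)

variable (k) in
/-- The arrow `y i : i → i - 1`. -/
def y (i : ZMod n) : Alg k n := mk k n (fy i)

variable (k n) in
/-- The central element `t = ∑ x i * y i`. -/
def t : Alg k n := ∑ i, x k i * y k i

variable (k n) in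
/-- The two-sided ideal `m` generated by the arrows. -/
def m : Ideal (Alg k n) :=
  (TwoSidedIdeal.span (Set.range (x k) ∪ Set.range (y k : ZMod n → Alg k n))).asIdeal

instance : (m k n).IsTwoSided := by unfold m; infer_instance

/-! ### Elementary identities in the algebra -/

lemma e_mul_e (i : ZMod n) : e k i * e k i = e k i := by
  simpa [e] using mk_rel (Rel.e_mul_e (k := k) i)

lemma e_mul_e_of_ne {i j : ZMod n} (h : i ≠ j) : e k i * e k j = 0 := by
  simpa [e] using mk_rel (Rel.e_mul_e_of_ne (k := k) i j h)

lemma sum_e : ∑ i : ZMod n, e k i = 1 := by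
  simpa [e] using mk_rel (Rel.sum_e (k := k) (n := n))

lemma e_mul_x (i : ZMod n) : e k i * x k i = x k i := by
  simpa [e, x] using mk_rel (Rel.e_mul_x (k := k) i)

lemma x_mul_e (i : ZMod n) : x k i * e k (i - 1) = x k i := by
  simpa [e, x] using mk_rel (Rel.x_mul_e (k := k) i)

lemma e_mul_y (i : ZMod n) : e k (i - 1) * y k i = y k i := by
  simpa [e, y] using mk_rel (Rel.e_mul_y (k := k) i)

lemma y_mul_e (i : ZMod n) : y k i * e k i = y k i := by
  simpa [e, y] using mk_rel (Rel.y_mul_e (k := k) i)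

lemma x_mul_y (i : ZMod n) : x k i * y k i = y k (i + 1) * x k (i + 1) := by
  simpa [x, y] using mk_rel (Rel.comm (k := k) i)

variable (k n) in
/-- The sum of all the arrows `x i`. -/
def sx : Alg k n := ∑ i, x k i

variable (k n) in
/-- The sum of all the arrows `y i`. -/
def sy : Alg k n := ∑ i, y k i

lemma sx_pow_mul_e (i : ZMod n) : sx k n ^ k * e k i = sy k n ^ (n - k) * e k i := by
  simpa [sx, sy, e, x, y] using mk_rel (Rel.pow (k := k) i)

lemma sx_pow : sx k n ^ k = sy k n ^ (n - k) := by
  have h := Finset.sum_congr (s₁ := Finset.univ) rfl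
    (fun (i : ZMod n) _ => sx_pow_mul_e (k := k) i)
  rwa [← Finset.mul_sum, ← Finset.mul_sum, sum_e, mul_one, mul_one] at h

lemma e_mul_sx (i : ZMod n) : e k i * sx k n = x k i := by
  rw [sx, Finset.mul_sum, Finset.sum_eq_single i, e_mul_x]
  · intro j _ hj
    rw [← e_mul_x j, ← mul_assoc, e_mul_e_of_ne (Ne.symm hj), zero_mul]
  · simp

lemma sx_mul_e (i : ZMod n) : sx k n * e k (i - 1) = x k i := by
  rw [sx, Finset.sum_mul, Finset.sum_eq_single i, x_mul_e]
  · intro j _ hj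
    rw [← x_mul_e j, mul_assoc, e_mul_e_of_ne (fun h => hj (sub_left_injective h)), mul_zero]
  · simp

lemma e_mul_sy (i : ZMod n) : e k (i - 1) * sy k n = y k i := by
  rw [sy, Finset.mul_sum, Finset.sum_eq_single i, e_mul_y]
  · intro j _ hj
    rw [← e_mul_y j, ← mul_assoc, e_mul_e_of_ne (fun h => hj (sub_left_injective h).symm), zero_mul]
  · simp

lemma sy_mul_e (i : ZMod n) : sy k n * e k i = y k i := by
  rw [sy, Finset.sum_mul, Finset.sum_eq_single i, y_mul_e]
  · intro j _ hj
    rw [← y_mul_e j, mul_assoc, e_mul_e_of_ne hj, mul_zero]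
  · simp

lemma sx_mul_sy : sx k n * sy k n = t k n := by
  rw [sx, Finset.sum_mul, t]
  refine Finset.sum_congr rfl fun i _ => ?_
  rw [← x_mul_e, mul_assoc, e_mul_sy, x_mul_e]

lemma sy_mul_sx : sy k n * sx k n = t k n := by
  rw [sy, Finset.sum_mul, t, ← Equiv.sum_comp (Equiv.addRight (1 : ZMod n))]
  refine Finset.sum_congr rfl fun i _ => ?_
  rw [Equiv.coe_addRight, ← y_mul_e, mul_assoc, e_mul_sx, x_mul_y]

lemma commute_sx_sy : Commute (sx k n) (sy k n) := sx_mul_sy.trans sy_mul_sx.symm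

lemma sx_pow_n (hk : k ≤ n) : sx k n ^ n = t k n ^ (n - k) := by
  rw [← sx_mul_sy, commute_sx_sy.mul_pow, ← sx_pow, ← pow_add, Nat.sub_add_cancel hk]

lemma sy_pow_n (hk : k ≤ n) : sy k n ^ n = t k n ^ k := by
  rw [← sx_mul_sy, commute_sx_sy.mul_pow, sx_pow, ← pow_add, Nat.sub_add_cancel hk]

/-- Induction on the generators. -/
lemma induction {p : Alg k n → Prop} (hs : ∀ c : ℂ, p (algebraMap ℂ _ c))
    (he : ∀ i, p (e k i)) (hx : ∀ i, p (x k i)) (hy : ∀ i, p (y k i))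
    (hadd : ∀ a b, p a → p b → p (a + b)) (hmul : ∀ a b, p a → p b → p (a * b))
    (a : Alg k n) : p a := by
  obtain ⟨a, rfl⟩ := mk_surjective a
  induction a using FreeAlgebra.induction with
  | grade0 r => simpa using hs r
  | grade1 g => cases g with
    | e i => exact he i
    | x i => exact hx i
    | y i => exact hy i
  | mul a b ha hb => simpa using hmul _ _ ha hb
  | add a b ha hb => simpa using hadd _ _ ha hb

lemma commute_t (a : Alg k n) : Commute (t k n) a := by
  have hX : Commute (t k n) (sx k n) := by
    rw [← sx_mul_sy]; exact (Commute.refl _).mul_left commute_sx_sy.symm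
  have hY : Commute (t k n) (sy k n) := by
    rw [← sx_mul_sy]; exact commute_sx_sy.mul_left (Commute.refl _)
  have hE (i : ZMod n) : Commute (t k n) (e k i) := by
    have h1 : t k n * e k i = x k i * y k i := by
      rw [← sx_mul_sy, mul_assoc, sy_mul_e, ← e_mul_y, ← mul_assoc, sx_mul_e, e_mul_y]
    have h2 : e k i * t k n = x k i * y k i := by
      rw [← sx_mul_sy, ← mul_assoc, e_mul_sx, ← x_mul_e, mul_assoc, e_mul_sy, x_mul_e]
    exact h1.trans h2.symm
  induction a using induction with
  | hs c => exact Algebra.commutes' c _ |>.symm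
  | he i => exact hE i
  | hx i => rw [← e_mul_sx]; exact (hE i).mul_right hX
  | hy i => rw [← e_mul_sy]; exact (hE _).mul_right hY
  | hadd a b ha hb => exact ha.add_right hb
  | hmul a b ha hb => exact ha.mul_right hb

lemma x_mem_m (i : ZMod n) : x k i ∈ m k n := by
  rw [m, TwoSidedIdeal.mem_asIdeal]
  exact TwoSidedIdeal.subset_span (Or.inl ⟨i, rfl⟩)

lemma t_mem_m : t k n ∈ m k n :=
  sum_mem fun i _ => Ideal.mul_mem_right _ _ (x_mem_m i)

/-! ### Powers of the arrow ideal lie in powers of `t` -/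

variable (k n) in
/-- The right ideal generated by the elements `x ^ a * y ^ b` with `a + b = s`. -/
def W (s : ℕ) : AddSubgroup (Alg k n) :=
  AddSubgroup.closure {z | ∃ a b r, a + b = s ∧ z = sx k n ^ a * sy k n ^ b * r}

lemma exists_e_mul (a b : ℕ) (i : ZMod n) :
    ∃ j, e k i * (sx k n ^ a * sy k n ^ b) = sx k n ^ a * sy k n ^ b * e k j := by
  induction a generalizing i with
  | zero =>
    simp only [pow_zero, one_mul]
    induction b generalizing i with
    | zero => exact ⟨i, by simp⟩
    | succ b ih =>
      obtain ⟨j, hj⟩ := ih (i + 1)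
      refine ⟨j, ?_⟩
      have h : e k i * sy k n = sy k n * e k (i + 1) := by
        have := e_mul_sy (k := k) (i + 1)
        rwa [add_sub_cancel_right, ← sy_mul_e] at this
      rw [pow_succ', ← mul_assoc, h, mul_assoc, hj, ← mul_assoc]
  | succ a ih =>
    obtain ⟨j, hj⟩ := ih (i - 1)
    refine ⟨j, ?_⟩
    have h : e k i * sx k n = sx k n * e k (i - 1) := by rw [e_mul_sx, sx_mul_e]
    rw [pow_succ', mul_assoc, ← mul_assoc, h, mul_assoc, hj]
    simp only [mul_assoc]

lemma W_closure {s s' : ℕ} {a : Alg k n}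
    (h : ∀ c d r, c + d = s → a * (sx k n ^ c * sy k n ^ d * r) ∈ W k n s') :
    ∀ z ∈ W k n s, a * z ∈ W k n s' := by
  intro z hz
  induction hz using AddSubgroup.closure_induction with
  | mem z hz => obtain ⟨c, d, r, hcd, rfl⟩ := hz; exact h c d r hcd
  | zero => simp
  | add x y _ _ hx hy => rw [mul_add]; exact add_mem hx hy
  | neg x _ hx => rw [mul_neg]; exact neg_mem hx

lemma e_mul_mem_W (i : ZMod n) (s : ℕ) : ∀ z ∈ W k n s, e k i * z ∈ W k n s := by
  refine W_closure fun c d r h => ?_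
  obtain ⟨j, hj⟩ := exists_e_mul (k := k) c d i
  refine AddSubgroup.subset_closure ⟨c, d, e k j * r, h, ?_⟩
  rw [← mul_assoc, hj, mul_assoc]

lemma sx_mul_mem_W (s : ℕ) : ∀ z ∈ W k n s, sx k n * z ∈ W k n (s + 1) := by
  refine W_closure fun c d r h => ?_
  refine AddSubgroup.subset_closure ⟨c + 1, d, r, by omega, ?_⟩
  simp only [pow_succ', mul_assoc]

lemma sy_mul_mem_W (s : ℕ) : ∀ z ∈ W k n s, sy k n * z ∈ W k n (s + 1) := by
  refine W_closure fun c d r h => ?_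
  refine AddSubgroup.subset_closure ⟨c, d + 1, r, by omega, ?_⟩
  simp only [pow_succ', ← mul_assoc, ← (commute_sx_sy.pow_left c).eq]

lemma x_mul_mem_W (i : ZMod n) (s : ℕ) : ∀ z ∈ W k n s, x k i * z ∈ W k n (s + 1) := by
  intro z hz
  rw [← e_mul_sx, mul_assoc]
  exact e_mul_mem_W _ _ _ (sx_mul_mem_W _ _ hz)

lemma y_mul_mem_W (i : ZMod n) (s : ℕ) : ∀ z ∈ W k n s, y k i * z ∈ W k n (s + 1) := by
  intro z hz
  rw [← e_mul_sy, mul_assoc]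
  exact e_mul_mem_W _ _ _ (sy_mul_mem_W _ _ hz)

lemma W_succ_le (s : ℕ) : W k n (s + 1) ≤ W k n s := by
  rw [W, AddSubgroup.closure_le]
  rintro z ⟨a, b, r, h, rfl⟩
  rcases a with _ | a
  · obtain ⟨b, rfl⟩ : ∃ c, b = c + 1 := ⟨s, by omega⟩
    exact AddSubgroup.subset_closure ⟨0, b, sy k n * r, by omega, by simp [pow_succ, mul_assoc]⟩
  · refine AddSubgroup.subset_closure ⟨a, b, sx k n * r, by omega, ?_⟩
    rw [pow_succ, mul_assoc (sx k n ^ a), (commute_sx_sy.pow_right b).eq]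
    simp only [mul_assoc]

lemma mul_mem_W (a : Alg k n) : ∀ s, ∀ z ∈ W k n s, a * z ∈ W k n s := by
  induction a using induction with
  | hs c =>
    intro s
    refine W_closure fun a b r h => AddSubgroup.subset_closure ⟨a, b, algebraMap ℂ _ c * r, h, ?_⟩
    rw [← mul_assoc, Algebra.commutes, mul_assoc]
  | he i => exact e_mul_mem_W i
  | hx i => exact fun s z hz => W_succ_le _ (x_mul_mem_W i s z hz)
  | hy i => exact fun s z hz => W_succ_le _ (y_mul_mem_W i s z hz)
  | hadd a b ha hb => intro s z hz; rw [add_mul]; exact add_mem (ha s z hz) (hb s z hz)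
  | hmul a b ha hb => intro s z hz; rw [mul_assoc]; exact ha s _ (hb s z hz)

lemma m_mul_mem_W {a : Alg k n} (ha : a ∈ m k n) :
    ∀ s, ∀ z ∈ W k n s, a * z ∈ W k n (s + 1) := by
  rw [m, TwoSidedIdeal.mem_asIdeal, TwoSidedIdeal.mem_span_iff_mem_addSubgroup_closure] at ha
  induction ha using AddSubgroup.closure_induction with
  | mem a ha =>
    obtain ⟨_, ⟨r, -, g, hg, rfl⟩, r', -, rfl⟩ := ha
    intro s z hz
    simp only [mul_assoc]
    refine mul_mem_W _ _ _ ?_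
    rcases hg with ⟨i, rfl⟩ | ⟨i, rfl⟩
    · exact x_mul_mem_W _ _ _ (mul_mem_W _ _ _ hz)
    · exact y_mul_mem_W _ _ _ (mul_mem_W _ _ _ hz)
  | zero => intro s z _; simp
  | add x y _ _ hx hy => intro s z hz; rw [add_mul]; exact add_mem (hx s z hz) (hy s z hz)
  | neg x _ hx => intro s z hz; rw [neg_mul]; exact neg_mem (hx s z hz)

lemma m_pow_le_W (s : ℕ) {a : Alg k n} (ha : a ∈ m k n ^ s) : a ∈ W k n s := by
  induction s generalizing a with
  | zero => exact AddSubgroup.subset_closure ⟨0, 0, a, rfl, by simp⟩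
  | succ s ih =>
    rw [Ideal.IsTwoSided.pow_succ] at ha
    refine Submodule.mul_induction_on ha (fun r hr z hz => m_mul_mem_W hr s z (ih hz))
      fun r z hr hz => add_mem hr hz

/-- The powers of the arrow ideal are eventually divisible by any given power of `t`. -/
lemma exists_eq_t_pow_mul (hk : 0 < k) (hkn : k < n) (d : ℕ) {a : Alg k n}
    (ha : a ∈ m k n ^ (2 * (n * d))) : ∃ r, a = t k n ^ d * r := by
  replace ha := m_pow_le_W _ ha
  induction ha using AddSubgroup.closure_induction with
  | mem a ha =>
    obtain ⟨a, b, r, h, rfl⟩ := ha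
    rcases le_total (n * d) a with h1 | h1
    · have : sx k n ^ a = t k n ^ d * (t k n ^ ((n - k) * d - d) * sx k n ^ (a - n * d)) := by
        rw [← mul_assoc, ← pow_add, Nat.add_sub_cancel' (Nat.le_mul_of_pos_left d (by omega)),
          pow_mul, ← sx_pow_n hkn.le, ← pow_mul, ← pow_add, Nat.add_sub_cancel' h1]
      exact ⟨_, by rw [this]; simp only [mul_assoc]; rfl⟩
    · have h2 : n * d ≤ b := by omega
      have : sy k n ^ b = t k n ^ d * (t k n ^ (k * d - d) * sy k n ^ (b - n * d)) := by
        rw [← mul_assoc, ← pow_add, Nat.add_sub_cancel' (Nat.le_mul_of_pos_left d (by omega)),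
          pow_mul, ← sy_pow_n hkn.le, ← pow_mul, ← pow_add, Nat.add_sub_cancel' h2]
      refine ⟨sx k n ^ a * (t k n ^ (k * d - d) * sy k n ^ (b - n * d)) * r, ?_⟩
      rw [this, ← mul_assoc (sx k n ^ a), ← ((commute_t (sx k n ^ a)).pow_left d).eq]
      simp only [mul_assoc]
  | zero => exact ⟨0, by simp⟩
  | add x y _ _ hx hy =>
    obtain ⟨r, rfl⟩ := hx; obtain ⟨r', rfl⟩ := hy; exact ⟨r + r', by rw [mul_add]⟩
  | neg x _ hx => obtain ⟨r, rfl⟩ := hx; exact ⟨-r, by rw [mul_neg]⟩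

end Alg

/-! ### The completed algebra -/

variable (k n) in
/-- The completion `B` of the algebra with respect to powers of the arrow ideal `m`: the
inverse limit of the quotients by `m ^ N`, as the subalgebra of compatible sequences. -/
def completion : Subalgebra ℂ (∀ N : ℕ, Alg k n ⧸ Alg.m k n ^ N) where
  carrier := {b | ∀ ⦃N N' : ℕ⦄ (h : N ≤ N'),
    Ideal.Quotient.factor (Ideal.pow_le_pow_right (I := Alg.m k n) h) (b N') = b N}
  mul_mem' := fun {a b} ha hb N N' h => by
    rw [Pi.mul_apply, map_mul, ha h, hb h, Pi.mul_apply]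
  add_mem' := fun {a b} ha hb N N' h => by
    rw [Pi.add_apply, map_add, ha h, hb h, Pi.add_apply]
  algebraMap_mem' := fun r N N' h => rfl

variable (k n) in
/-- The algebra `B_{k,n}`. -/
abbrev B : Type := completion k n

namespace B

variable (k n) in
/-- The canonical map from the algebra to its completion. -/
def of : Alg k n →ₐ[ℂ] B k n where
  toFun a := ⟨fun _ => Ideal.Quotient.mk _ a, fun _ _ _ => rfl⟩
  map_one' := rfl
  map_mul' _ _ := rfl
  map_zero' := rfl
  map_add' _ _ := rfl
  commutes' _ := rfl

/-- If `a` lifts the `N'`-th component of `b` and `N ≤ N'`, then it lifts the `N`-th one. -/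
lemma lift_le (b : B k n) {N N' : ℕ} (h : N ≤ N') {a : Alg k n}
    (ha : Ideal.Quotient.mk _ a = b.1 N') : Ideal.Quotient.mk _ a = b.1 N := by
  rw [← b.2 h, ← ha]; rfl

lemma trunc_mul_sub (f g : ℂ⟦X⟧) (N : ℕ) :
    Polynomial.X ^ N ∣ f.trunc N * g.trunc N - (f * g).trunc N := by
  rw [Polynomial.X_pow_dvd_iff]
  intro d hd
  have h := PowerSeries.trunc_trunc_mul_trunc (n := N) f g
  rw [← h, Polynomial.coeff_sub, PowerSeries.coeff_trunc, if_pos hd, ← Polynomial.coe_mul,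
    Polynomial.coeff_coe, sub_self]

lemma mk_aeval_of_dvd {N : ℕ} {p q : Polynomial ℂ} (h : Polynomial.X ^ N ∣ p - q) :
    Ideal.Quotient.mk (Alg.m k n ^ N) (Polynomial.aeval (Alg.t k n) p) =
      Ideal.Quotient.mk (Alg.m k n ^ N) (Polynomial.aeval (Alg.t k n) q) := by
  obtain ⟨r, hr⟩ := h
  rw [Ideal.Quotient.mk_eq_mk_iff_sub_mem, ← map_sub, hr, map_mul, map_pow, Polynomial.aeval_X]
  exact Ideal.mul_mem_right _ _ (Ideal.pow_mem_pow Alg.t_mem_m N)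

variable (k n) in
/-- The ring homomorphism `ℂ⟦t⟧ → B_{k,n}` that sends `∑ c j t ^ j` to the convergent
sum `∑ c j (∑ x i * y i) ^ j`. -/
def ofPowerSeries : ℂ⟦X⟧ →+* B k n where
  toFun f := ⟨fun N => Ideal.Quotient.mk _ (Polynomial.aeval (Alg.t k n) (f.trunc N)), by
    intro N N' h
    rw [Ideal.Quotient.factor_mk]
    refine mk_aeval_of_dvd ?_
    rw [Polynomial.X_pow_dvd_iff]
    intro d hd
    rw [Polynomial.coeff_sub, PowerSeries.coeff_trunc, PowerSeries.coeff_trunc, if_pos hd,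
      if_pos (hd.trans_le h), sub_self]⟩
  map_one' := by
    refine Subtype.ext (funext fun N => ?_)
    rcases N with _ | N
    · exact (Ideal.Quotient.eq).2 (by rw [Submodule.pow_zero, Ideal.one_eq_top]; trivial)
    · simp [PowerSeries.trunc_one]
  map_mul' f g := by
    refine Subtype.ext (funext fun N => ?_)
    refine (mk_aeval_of_dvd (trunc_mul_sub f g N)).symm.trans ?_
    rw [map_mul, map_mul]; rfl
  map_zero' := by
    refine Subtype.ext (funext fun N => ?_)
    simp
  map_add' f g := by
    refine Subtype.ext (funext fun N => ?_)
    simp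

/-- `B_{k,n}` is an algebra over `Z = ℂ⟦t⟧`, where `t` acts as the central element
`∑ x i * y i`. -/
instance : Algebra ℂ⟦X⟧ (B k n) :=
  (ofPowerSeries k n).toAlgebra' fun f b => by
    refine Subtype.ext (funext fun N => ?_)
    obtain ⟨a, ha⟩ := Ideal.Quotient.mk_surjective (b.1 N)
    change Ideal.Quotient.mk _ (Polynomial.aeval (Alg.t k n) (f.trunc N)) * b.1 N =
      b.1 N * Ideal.Quotient.mk _ (Polynomial.aeval (Alg.t k n) (f.trunc N))
    rw [← ha, ← map_mul, ← map_mul]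
    congr 1
    generalize f.trunc N = p
    induction p using Polynomial.induction_on' with
    | add p q hp hq => rw [map_add, add_mul, mul_add, hp, hq]
    | monomial d c =>
      rw [Polynomial.aeval_monomial]
      exact ((show Commute _ _ from Algebra.commutes c a).mul_left ((Alg.commute_t a).pow_left d)).eq

/-! ### Extending representations to the completion -/

section Extend

variable {ι : Type}

/-- A representation of the algebra on a free `ℂ⟦t⟧`-module is `t`-adically continuous if
for each `d` some power of the arrow ideal has image divisible by `t ^ d`. -/
def IsContinuous (ρ : Alg k n →ₐ[ℂ] Module.End ℂ⟦X⟧ (ι → ℂ⟦X⟧)) : Prop :=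
  ∀ d : ℕ, ∃ N : ℕ, ∀ a ∈ Alg.m k n ^ N, ∀ u i, PowerSeries.X ^ d ∣ ρ a u i

lemma isContinuous_of_t (hk : 0 < k) (hkn : k < n)
    (ρ : Alg k n →ₐ[ℂ] Module.End ℂ⟦X⟧ (ι → ℂ⟦X⟧))
    (h : ∀ u, ρ (Alg.t k n) u = (PowerSeries.X : ℂ⟦X⟧) • u) : IsContinuous ρ := by
  intro d
  refine ⟨2 * (n * d), fun a ha u i => ?_⟩
  obtain ⟨r, rfl⟩ := Alg.exists_eq_t_pow_mul hk hkn d ha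
  have h' (u) : ρ (Alg.t k n ^ d) u = (PowerSeries.X ^ d : ℂ⟦X⟧) • u := by
    clear ha
    induction d with
    | zero => simp
    | succ d ih => rw [pow_succ', map_mul, Module.End.mul_apply, h, pow_succ', mul_smul, ih]
  rw [map_mul, Module.End.mul_apply, h']
  exact ⟨_, rfl⟩

variable (ρ : Alg k n →ₐ[ℂ] Module.End ℂ⟦X⟧ (ι → ℂ⟦X⟧)) (hρ : IsContinuous ρ)

/-- The limit of `ρ a u`, where `a` runs through lifts of the components of `b`:
its coefficients are eventually constant. -/
def act (b : B k n) (u : ι → ℂ⟦X⟧) : ι → ℂ⟦X⟧ := fun i => PowerSeries.mk fun d =>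
  PowerSeries.coeff d
    (ρ (Ideal.Quotient.mk_surjective (b.1 (hρ (d + 1)).choose)).choose u i)

lemma dvd_sub_of_lift {d : ℕ} {a a' : Alg k n}
    (h : (Ideal.Quotient.mk (Alg.m k n ^ (hρ d).choose)) a = Ideal.Quotient.mk _ a')
    (u : ι → ℂ⟦X⟧) (i : ι) : PowerSeries.X ^ d ∣ ρ a u i - ρ a' u i := by
  have := (hρ d).choose_spec (a - a') ((Ideal.Quotient.mk_eq_mk_iff_sub_mem _ _).1 h) u i
  simpa using this

/-- The extended action is approximated by the action of lifts. -/
lemma act_spec (b : B k n) (D : ℕ) : ∃ N₀ : ℕ, ∀ N, N₀ ≤ N → ∀ a : Alg k n,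
    Ideal.Quotient.mk _ a = b.1 N →
      ∀ u i, PowerSeries.X ^ D ∣ act ρ hρ b u i - ρ a u i := by
  refine ⟨(Finset.range (D + 1)).sup fun d => (hρ d).choose, fun N hN a ha u i => ?_⟩
  rw [PowerSeries.X_pow_dvd_iff]
  intro d hd
  have h1 : (hρ (d + 1)).choose ≤ N :=
    (Finset.le_sup (f := fun d => (hρ d).choose) (Finset.mem_range.2 (by omega))).trans hN
  have h2 := (Ideal.Quotient.mk_surjective (b.1 (hρ (d + 1)).choose)).choose_spec
  have h3 := dvd_sub_of_lift ρ hρ (h2.trans (lift_le b h1 ha).symm) u i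
  rw [PowerSeries.X_pow_dvd_iff] at h3
  have h4 := h3 d (by omega)
  rw [map_sub] at h4 ⊢
  rwa [act, PowerSeries.coeff_mk]

lemma eq_of_forall_dvd {f g : ℂ⟦X⟧} (h : ∀ D, PowerSeries.X ^ D ∣ f - g) : f = g := by
  ext d
  have := PowerSeries.X_pow_dvd_iff.1 (h (d + 1)) d (by omega)
  rwa [map_sub, sub_eq_zero] at this

lemma exists_lift (b : B k n) (N : ℕ) : ∃ a : Alg k n, Ideal.Quotient.mk _ a = b.1 N :=
  Ideal.Quotient.mk_surjective _

/-- A common approximation for finitely many elements. -/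
lemma act_approx (b : B k n) (D : ℕ) : ∀ᶠ N in Filter.atTop, ∀ a : Alg k n,
    Ideal.Quotient.mk _ a = b.1 N →
      ∀ u i, PowerSeries.X ^ D ∣ act ρ hρ b u i - ρ a u i := by
  obtain ⟨N₀, h⟩ := act_spec ρ hρ b D
  exact Filter.eventually_atTop.2 ⟨N₀, h⟩

lemma act_of (a : Alg k n) (u : ι → ℂ⟦X⟧) : act ρ hρ (of k n a) u = ρ a u := by
  refine funext fun i => eq_of_forall_dvd fun D => ?_
  obtain ⟨N, h⟩ := (act_approx ρ hρ (of k n a) D).exists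
  exact h a rfl u i

lemma act_add_left (b b' : B k n) (u : ι → ℂ⟦X⟧) :
    act ρ hρ (b + b') u = act ρ hρ b u + act ρ hρ b' u := by
  refine funext fun i => eq_of_forall_dvd fun D => ?_
  obtain ⟨N, h1, h2, h3⟩ := ((act_approx ρ hρ b D).and
    ((act_approx ρ hρ b' D).and (act_approx ρ hρ (b + b') D))).exists
  obtain ⟨a, ha⟩ := exists_lift b N
  obtain ⟨a', ha'⟩ := exists_lift b' N
  have h3 := h3 (a + a') (by rw [map_add, ha, ha']; rfl) u i
  rw [map_add] at h3
  have := dvd_sub h3 (dvd_add (h1 a ha u i) (h2 a' ha' u i))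
  convert this using 1
  simp only [LinearMap.add_apply, Pi.add_apply]
  ring

lemma act_mul (b b' : B k n) (u : ι → ℂ⟦X⟧) [Finite ι] :
    act ρ hρ (b * b') u = act ρ hρ b (act ρ hρ b' u) := by
  classical
  cases nonempty_fintype ι
  refine funext fun i => eq_of_forall_dvd fun D => ?_
  obtain ⟨N, h1, h2, h3⟩ := ((act_approx ρ hρ b D).and
    ((act_approx ρ hρ b' D).and (act_approx ρ hρ (b * b') D))).exists
  obtain ⟨a, ha⟩ := exists_lift b N
  obtain ⟨a', ha'⟩ := exists_lift b' N
  have h3 := h3 (a * a') (by rw [map_mul, ha, ha']; rfl) u i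
  have h1 := h1 a ha (act ρ hρ b' u) i
  have h2 := h2 a' ha' u
  choose v hv using h2
  have h4 : act ρ hρ b' u = ρ a' u + (PowerSeries.X ^ D : ℂ⟦X⟧) • v := by
    funext j
    rw [Pi.add_apply, Pi.smul_apply, smul_eq_mul, ← hv j]; ring
  rw [map_mul, Module.End.mul_apply] at h3
  have h5 : PowerSeries.X ^ D ∣ ρ a (act ρ hρ b' u) i - ρ a (ρ a' u) i := by
    refine ⟨ρ a v i, ?_⟩
    conv_lhs => rw [h4]
    rw [map_add, map_smul, Pi.add_apply, Pi.smul_apply, smul_eq_mul]; ring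
  have := dvd_sub h3 (dvd_add h1 h5)
  convert this using 1
  ring

lemma act_add_right (b : B k n) (u v : ι → ℂ⟦X⟧) :
    act ρ hρ b (u + v) = act ρ hρ b u + act ρ hρ b v := by
  refine funext fun i => eq_of_forall_dvd fun D => ?_
  obtain ⟨N, h1⟩ := (act_approx ρ hρ b D).exists
  obtain ⟨a, ha⟩ := exists_lift b N
  have h1 := h1 a ha
  have := dvd_sub (h1 (u + v) i) (dvd_add (h1 u i) (h1 v i))
  convert this using 1
  rw [map_add]
  simp only [Pi.add_apply]
  ring

lemma act_smul (b : B k n) (f : ℂ⟦X⟧) (u : ι → ℂ⟦X⟧) :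
    act ρ hρ b (f • u) = f • act ρ hρ b u := by
  refine funext fun i => eq_of_forall_dvd fun D => ?_
  obtain ⟨N, h1⟩ := (act_approx ρ hρ b D).exists
  obtain ⟨a, ha⟩ := exists_lift b N
  have h1 := h1 a ha
  have := dvd_sub (h1 (f • u) i) (Dvd.dvd.mul_left (h1 u i) f)
  convert this using 1
  rw [map_smul]
  simp only [Pi.smul_apply, smul_eq_mul]
  ring

/-- The extension of a continuous representation to the completed algebra. -/
def extend [Finite ι] : B k n →+* Module.End ℂ⟦X⟧ (ι → ℂ⟦X⟧) where
  toFun b :=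
    { toFun := act ρ hρ b
      map_add' := act_add_right ρ hρ b
      map_smul' := act_smul ρ hρ b }
  map_one' := LinearMap.ext fun u => by
    change act ρ hρ 1 u = u
    rw [← map_one (of k n), act_of, map_one, Module.End.one_apply]
  map_zero' := LinearMap.ext fun u => by
    change act ρ hρ 0 u = 0
    rw [← map_zero (of k n), act_of, map_zero, LinearMap.zero_apply]
  map_mul' b b' := LinearMap.ext fun u => act_mul ρ hρ b b' u
  map_add' b b' := LinearMap.ext fun u => act_add_left ρ hρ b b' u

end Extend

end B

/-! ### Rims and rank one modules -/

variable (k n) in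
/-- A rim: a `k`-element subset of the edge set `ZMod n`. -/
abbrev Rim : Type := {I : Finset (ZMod n) // I.card = k}

namespace Rim

/-- The scalar by which `x i : U (i - 1) → U i` acts on the rank one module. -/
def cx (I : Rim k n) (i : ZMod n) : ℂ⟦X⟧ := if i ∈ I.1 then 1 else PowerSeries.X

/-- The scalar by which `y i : U i → U (i - 1)` acts on the rank one module. -/
def cy (I : Rim k n) (i : ZMod n) : ℂ⟦X⟧ := if i ∈ I.1 then PowerSeries.X else 1

lemma cx_mul_cy (I : Rim k n) (i : ZMod n) : I.cx i * I.cy i = PowerSeries.X := by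
  unfold cx cy; split_ifs <;> simp

/-- The action of the generators on `⨁ U i`, with `U i = ℂ⟦t⟧` for every vertex `i`. -/
def gen (I : Rim k n) : Gen n → Module.End ℂ⟦X⟧ (ZMod n → ℂ⟦X⟧)
  | .e i => LinearMap.single ℂ⟦X⟧ (fun _ => ℂ⟦X⟧) i ∘ₗ LinearMap.proj i
  | .x i => LinearMap.single ℂ⟦X⟧ (fun _ => ℂ⟦X⟧) i ∘ₗ (I.cx i • LinearMap.proj (i - 1))
  | .y i => LinearMap.single ℂ⟦X⟧ (fun _ => ℂ⟦X⟧) (i - 1) ∘ₗ (I.cy i • LinearMap.proj i)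

lemma gen_e (I : Rim k n) (i : ZMod n) (u : ZMod n → ℂ⟦X⟧) :
    I.gen (.e i) u = Pi.single i (u i) := rfl

lemma gen_x (I : Rim k n) (i : ZMod n) (u : ZMod n → ℂ⟦X⟧) :
    I.gen (.x i) u = Pi.single i (I.cx i * u (i - 1)) := rfl

lemma gen_y (I : Rim k n) (i : ZMod n) (u : ZMod n → ℂ⟦X⟧) :
    I.gen (.y i) u = Pi.single (i - 1) (I.cy i * u i) := rfl

lemma sum_gen_x (I : Rim k n) (u : ZMod n → ℂ⟦X⟧) (i : ZMod n) :
    (∑ j, I.gen (.x j)) u i = I.cx i * u (i - 1) := by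
  simp [LinearMap.sum_apply, gen_x, Pi.single_apply]

lemma sum_gen_y (I : Rim k n) (u : ZMod n → ℂ⟦X⟧) (i : ZMod n) :
    (∑ j, I.gen (.y j)) u i = I.cy (i + 1) * u (i + 1) := by
  rw [LinearMap.sum_apply, Finset.sum_apply, Finset.sum_eq_single (i + 1)]
  · rw [gen_y, add_sub_cancel_right, Pi.single_eq_same]
  · intro j _ hj
    rw [gen_y, Pi.single_eq_of_ne]
    rintro rfl
    simp at hj
  · simp

lemma sum_gen_x_pow (I : Rim k n) (s : ℕ) (u : ZMod n → ℂ⟦X⟧) (i : ZMod n) :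
    ((∑ j, I.gen (.x j)) ^ s) u i = (∏ l ∈ Finset.range s, I.cx (i - l)) * u (i - s) := by
  induction s generalizing u with
  | zero => simp
  | succ s ih =>
    rw [pow_succ, Module.End.mul_apply, ih, sum_gen_x, Finset.prod_range_succ]
    push_cast
    rw [mul_assoc, sub_sub]

lemma prod_cx (I : Rim k n) : ∏ i, I.cx i = PowerSeries.X ^ (n - k) := by
  unfold cx
  rw [Finset.prod_ite, Finset.prod_const_one, one_mul, Finset.prod_const]
  congr 1
  rw [Finset.filter_not, Finset.card_sdiff_of_subset (Finset.filter_subset _ _),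
    Finset.card_univ, ZMod.card, Finset.filter_mem_eq_inter, Finset.univ_inter, I.2]

lemma sum_gen_x_pow_n (I : Rim k n) (u : ZMod n → ℂ⟦X⟧) :
    ((∑ j, I.gen (.x j)) ^ n) u = (PowerSeries.X ^ (n - k) : ℂ⟦X⟧) • u := by
  funext i
  rw [sum_gen_x_pow, ZMod.natCast_self, sub_zero, Pi.smul_apply, smul_eq_mul, ← prod_cx I]
  congr 1
  refine Finset.prod_bij (fun l _ => i - l) (fun _ _ => Finset.mem_univ _) ?_ ?_ ?_
  · intro a ha b hb h
    have h' : (a : ZMod n) = b := sub_right_injective h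
    rw [ZMod.natCast_eq_natCast_iff] at h'
    exact Nat.ModEq.eq_of_lt_of_lt h' (Finset.mem_range.1 ha) (Finset.mem_range.1 hb)
  · intro j _
    exact ⟨(i - j).val, Finset.mem_range.2 (ZMod.val_lt _), by simp⟩
  · intros; rfl

lemma card_le (I : Rim k n) : k ≤ n := by
  have := Finset.card_le_univ I.1
  rwa [I.2, ZMod.card] at this

lemma sum_gen_x_mul_y (I : Rim k n) (u : ZMod n → ℂ⟦X⟧) :
    ((∑ j, I.gen (.x j)) * ∑ j, I.gen (.y j)) u = (PowerSeries.X : ℂ⟦X⟧) • u := by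
  funext i
  rw [Module.End.mul_apply, sum_gen_x, sum_gen_y, sub_add_cancel, ← mul_assoc, cx_mul_cy]; rfl

lemma sum_gen_y_mul_x (I : Rim k n) (u : ZMod n → ℂ⟦X⟧) :
    ((∑ j, I.gen (.y j)) * ∑ j, I.gen (.x j)) u = (PowerSeries.X : ℂ⟦X⟧) • u := by
  funext i
  rw [Module.End.mul_apply, sum_gen_y, sum_gen_x, add_sub_cancel_right, ← mul_assoc,
    mul_comm (I.cy _), cx_mul_cy]; rfl

lemma sum_gen_x_pow_k (I : Rim k n) :
    (∑ j, I.gen (.x j)) ^ k = (∑ j, I.gen (.y j)) ^ (n - k) := by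
  set x := ∑ j, I.gen (.x j) with hx
  set y := ∑ j, I.gen (.y j) with hy
  have hxy : x * y = y * x := LinearMap.ext fun u =>
    (I.sum_gen_x_mul_y u).trans (I.sum_gen_y_mul_x u).symm
  have hc : Commute x y := hxy
  have hX (s : ℕ) (u) : ((y * x) ^ s) u = (PowerSeries.X ^ s : ℂ⟦X⟧) • u := by
    induction s with
    | zero => simp
    | succ s ih =>
      rw [pow_succ', Module.End.mul_apply, ih, I.sum_gen_y_mul_x, pow_succ', mul_smul]
  have h1 : x ^ (n - k) * x ^ k = x ^ (n - k) * y ^ (n - k) := by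
    rw [← pow_add, Nat.sub_add_cancel I.card_le, ← hc.mul_pow, hxy]
    exact LinearMap.ext fun u => (I.sum_gen_x_pow_n u).trans (hX _ u).symm
  have h2 : (y * x) ^ (n - k) * x ^ k = (y * x) ^ (n - k) * y ^ (n - k) := by
    rw [hc.symm.mul_pow, mul_assoc, h1, ← mul_assoc]
  refine LinearMap.ext fun u => ?_
  have h3 := LinearMap.congr_fun h2 u
  rw [Module.End.mul_apply, Module.End.mul_apply, hX, hX] at h3
  exact smul_right_injective _ (pow_ne_zero _ PowerSeries.X_ne_zero) h3

/-- The representation of the uncompleted algebra given by a rim. -/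
def rep (I : Rim k n) : Alg k n →ₐ[ℂ] Module.End ℂ⟦X⟧ (ZMod n → ℂ⟦X⟧) :=
  Alg.lift (FreeAlgebra.lift ℂ I.gen) <| by
    intro a b h
    cases h with
    | e_mul_e i => ext u; simp [gen_e]
    | e_mul_e_of_ne i j h => ext u; simp [gen_e, h]
    | sum_e =>
      refine LinearMap.ext fun u => funext fun j => ?_
      simp [gen_e, LinearMap.sum_apply, Pi.single_apply]
    | e_mul_x i => refine LinearMap.ext fun u => ?_; simp [gen_e, gen_x]
    | x_mul_e i => refine LinearMap.ext fun u => ?_; simp [gen_e, gen_x]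
    | e_mul_y i => refine LinearMap.ext fun u => ?_; simp [gen_e, gen_y]
    | y_mul_e i => refine LinearMap.ext fun u => ?_; simp [gen_e, gen_y]
    | comm i =>
      refine LinearMap.ext fun u => ?_
      simp only [map_mul, FreeAlgebra.lift_ι_apply, Module.End.mul_apply, gen_x, gen_y,
        Pi.single_eq_same, add_sub_cancel_right, ← mul_assoc, cx_mul_cy]
      rw [mul_comm (I.cy _), cx_mul_cy]
    | pow i => simp only [map_mul, map_pow, map_sum, FreeAlgebra.lift_ι_apply, sum_gen_x_pow_k]

lemma rep_e (I : Rim k n) (i : ZMod n) : I.rep (Alg.e k i) = I.gen (.e i) := by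
  simp [rep, Alg.e, Alg.lift_mk]

lemma rep_x (I : Rim k n) (i : ZMod n) : I.rep (Alg.x k i) = I.gen (.x i) := by
  simp [rep, Alg.x, Alg.lift_mk]

lemma rep_y (I : Rim k n) (i : ZMod n) : I.rep (Alg.y k i) = I.gen (.y i) := by
  simp [rep, Alg.y, Alg.lift_mk]

lemma isContinuous_rep (hk : 0 < k) (hkn : k < n) (I : Rim k n) : B.IsContinuous I.rep := by
  refine B.isContinuous_of_t hk hkn _ fun u => ?_
  rw [← Alg.sx_mul_sy, Alg.sx, Alg.sy, map_mul, map_sum, map_sum]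
  simp only [rep_x, rep_y]
  exact I.sum_gen_x_mul_y u

end Rim

/-- The rank one module `L_I` of a rim `I`, with one copy of `ℂ⟦t⟧` for each vertex. -/
def RankOne (_ : 0 < k) (_ : k < n) (_ : Rim k n) : Type := ZMod n → ℂ⟦X⟧

namespace RankOne

variable (hk : 0 < k) (hkn : k < n) (I : Rim k n)

instance : AddCommGroup (RankOne hk hkn I) := inferInstanceAs (AddCommGroup (ZMod n → ℂ⟦X⟧))

instance : Module (Module.End ℂ⟦X⟧ (ZMod n → ℂ⟦X⟧)) (RankOne hk hkn I) :=
  inferInstanceAs (Module (Module.End ℂ⟦X⟧ (ZMod n → ℂ⟦X⟧)) (ZMod n → ℂ⟦X⟧))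

/-- The action of `B_{k,n}` on `L_I`. -/
instance : Module (B k n) (RankOne hk hkn I) :=
  Module.compHom _ (B.extend I.rep (I.isContinuous_rep hk hkn))

/-- The arrow `x i` acts as multiplication by `1` if `i ∈ I` and by `t` otherwise. -/
lemma x_smul (i : ZMod n) (u : ZMod n → ℂ⟦X⟧) :
    (B.of k n (Alg.x k i) • (show RankOne hk hkn I from u) : RankOne hk hkn I) =
      (Pi.single i ((if i ∈ I.1 then 1 else PowerSeries.X) * u (i - 1)) : ZMod n → ℂ⟦X⟧) :=
  (B.act_of I.rep (I.isContinuous_rep hk hkn) _ _).trans (by rw [I.rep_x]; rfl)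

/-- The arrow `y i` acts as multiplication by `t` if `i ∈ I` and by `1` otherwise. -/
lemma y_smul (i : ZMod n) (u : ZMod n → ℂ⟦X⟧) :
    (B.of k n (Alg.y k i) • (show RankOne hk hkn I from u) : RankOne hk hkn I) =
      (Pi.single (i - 1) ((if i ∈ I.1 then PowerSeries.X else 1) * u i) : ZMod n → ℂ⟦X⟧) :=
  (B.act_of I.rep (I.isContinuous_rep hk hkn) _ _).trans (by rw [I.rep_y]; rfl)

/-- The trivial path `e i` acts as the projection to `U i`. -/
lemma e_smul (i : ZMod n) (u : ZMod n → ℂ⟦X⟧) :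
    (B.of k n (Alg.e k i) • (show RankOne hk hkn I from u) : RankOne hk hkn I) =
      (Pi.single i (u i) : ZMod n → ℂ⟦X⟧) :=
  (B.act_of I.rep (I.isContinuous_rep hk hkn) _ _).trans (by rw [I.rep_e]; rfl)

/-- `L_I` as an object of the category of left `B_{k,n}`-modules. -/
abbrev obj : ModuleCat.{0} (B k n) := ModuleCat.of (B k n) (RankOne hk hkn I)

end RankOne

/-- `Ext¹_B(L_I, L_J)`, in the category of left `B_{k,n}`-modules. It is a module over `ℂ⟦t⟧` and
over `ℂ`, since `B_{k,n}` is an algebra over both. -/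
abbrev Ext1 (hk : 0 < k) (hkn : k < n) (I J : Rim k n) : Type :=
  Abelian.Ext (RankOne.obj hk hkn I) (RankOne.obj hk hkn J) 1

/-- The one-dimensional `ℂ⟦t⟧`-module `ℂ = ℂ⟦t⟧ / (t)`. -/
abbrev ResidueField : Type := ℂ⟦X⟧ ⧸ Ideal.span {(PowerSeries.X : ℂ⟦X⟧)}

/-! ### Crossing and interlacing rims -/

/-- A tuple of elements of `ZMod n` that is strictly cyclically ordered. -/
def CyclicallyOrdered {r : ℕ} (a : Fin r → ZMod n) : Prop :=
  ∀ i j l, i < j → j < l → sbtw (a i) (a j) (a l)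

/-- There are `r` elements of `I \ J` and `r` elements of `J \ I` that alternate cyclically
(the tuple is indexed from `0`, so the elements of `I \ J` have the even indices). -/
def HasAlternating (r : ℕ) (I J : Rim k n) : Prop :=
  ∃ a : Fin (2 * r) → ZMod n, CyclicallyOrdered a ∧
    ∀ j, (Even j.val → a j ∈ I.1 \ J.1) ∧ (Odd j.val → a j ∈ J.1 \ I.1)

/-- `I` and `J` are `r`-interlacing: `r` is the largest size of alternating subsets. -/
def Interlacing (r : ℕ) (I J : Rim k n) : Prop :=
  HasAlternating r I J ∧ ∀ s, r < s → ¬ HasAlternating s I J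

/-- `I` and `J` are crossing, that is, not weakly separated: there are cyclically ordered `a, b, c, d`
with `a, c` in `I \ J` and `b, d` in `J \ I`. -/
def Crossing (I J : Rim k n) : Prop :=
  ∃ a b c d : ZMod n, CyclicallyOrdered ![a, b, c, d] ∧
    a ∈ I.1 \ J.1 ∧ c ∈ I.1 \ J.1 ∧ b ∈ J.1 \ I.1 ∧ d ∈ J.1 \ I.1

end BoundaryAlgebra

end

noncomputable section

namespace BoundaryAlgebra

variable {k n : ℕ} [NeZero n]

namespace B

instance : Ring (B k n) := inferInstance

instance : Semiring (B k n) := inferInstance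

instance : NonUnitalNonAssocSemiring (B k n) := inferInstance

instance : NonAssocSemiring (B k n) := inferInstance

instance : NonUnitalSemiring (B k n) := inferInstance

instance : Monoid (B k n) := inferInstance

lemma algebraMap_X : algebraMap ℂ⟦X⟧ (B k n) PowerSeries.X = of k n (Alg.t k n) := by
  refine Subtype.ext (funext fun N => ?_)
  change Ideal.Quotient.mk _ (Polynomial.aeval (Alg.t k n) (PowerSeries.trunc N PowerSeries.X)) =
    Ideal.Quotient.mk _ (Alg.t k n)
  have h : Polynomial.X ^ N ∣ PowerSeries.trunc N (PowerSeries.X : ℂ⟦X⟧) - Polynomial.X := by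
    rw [Polynomial.X_pow_dvd_iff]
    intro d hd
    rw [Polynomial.coeff_sub, PowerSeries.coeff_trunc, if_pos hd, PowerSeries.coeff_X,
      Polynomial.coeff_X, sub_eq_zero]
    simp only [eq_comm]
  rw [mk_aeval_of_dvd h, Polynomial.aeval_X]

lemma algebraMap_C (c : ℂ) :
    algebraMap ℂ⟦X⟧ (B k n) (PowerSeries.C c) = algebraMap ℂ (B k n) c := by
  refine Subtype.ext (funext fun N => ?_)
  change Ideal.Quotient.mk _ (Polynomial.aeval (Alg.t k n) (PowerSeries.trunc N (PowerSeries.C c))) =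
    Ideal.Quotient.mk _ (algebraMap ℂ _ c)
  have h : Polynomial.X ^ N ∣ PowerSeries.trunc N (PowerSeries.C c) - Polynomial.C c := by
    rw [Polynomial.X_pow_dvd_iff]
    intro d hd
    rw [Polynomial.coeff_sub, PowerSeries.coeff_trunc, if_pos hd, PowerSeries.coeff_C,
      Polynomial.coeff_C, sub_self]
  rw [mk_aeval_of_dvd h, Polynomial.aeval_C]

lemma algebraMap_X_pow (d : ℕ) :
    algebraMap ℂ⟦X⟧ (B k n) (PowerSeries.X ^ d) = of k n (Alg.t k n) ^ d := by
  rw [map_pow, algebraMap_X]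

/-- An element of the completion with a vanishing component is divisible by a power of `t`. -/
lemma exists_eq_of_t_pow_mul (hk : 0 < k) (hkn : k < n) (d : ℕ) (b : B k n)
    (hb : b.1 (2 * (n * d)) = 0) : ∃ b', b = of k n (Alg.t k n) ^ d * b' := by
  choose a ha using fun s : ℕ => exists_lift b (2 * (n * (d + s)))
  have ha0 : a 0 ∈ Alg.m k n ^ (2 * (n * d)) := by
    rw [← Ideal.Quotient.eq_zero_iff_mem, ← hb]; exact ha 0
  have hle {s s' : ℕ} (h : s ≤ s') : 2 * (n * (d + s)) ≤ 2 * (n * (d + s')) := by gcongr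
  have hsub (s : ℕ) : a (s + 1) - a s ∈ Alg.m k n ^ (2 * (n * (d + s))) := by
    rw [← Ideal.Quotient.mk_eq_mk_iff_sub_mem, ha s]
    exact lift_le b (hle s.le_succ) (ha (s + 1))
  obtain ⟨r0, hr0⟩ := Alg.exists_eq_t_pow_mul hk hkn d ha0
  choose r hr using fun s => Alg.exists_eq_t_pow_mul hk hkn (d + s) (hsub s)
  have hsum (N : ℕ) : a N =
      Alg.t k n ^ d * (r0 + ∑ s ∈ Finset.range N, Alg.t k n ^ s * r s) := by
    induction N with
    | zero => simpa using hr0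
    | succ N ih =>
      rw [← sub_add_cancel (a (N + 1)) (a N), hr, ih, Finset.sum_range_succ, pow_add]
      simp only [mul_add, mul_assoc]
      abel
  refine ⟨⟨fun N => Ideal.Quotient.mk _ (r0 + ∑ s ∈ Finset.range N, Alg.t k n ^ s * r s), ?_⟩, ?_⟩
  · intro N N' h
    rw [Ideal.Quotient.factor_mk, Ideal.Quotient.mk_eq_mk_iff_sub_mem, add_sub_add_left_eq_sub,
      ← Finset.sum_sdiff_eq_sub (Finset.range_subset_range.2 h)]
    refine sum_mem fun s hs => Ideal.mul_mem_right _ _ ?_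
    have hs : N ≤ s := by simpa using (Finset.mem_sdiff.1 hs).2
    exact Ideal.pow_le_pow_right hs (Ideal.pow_mem_pow Alg.t_mem_m s)
  · refine Subtype.ext (funext fun N => ?_)
    have h : N ≤ 2 * (n * (d + N)) := by
      have := Nat.pos_of_ne_zero (NeZero.ne n)
      nlinarith [Nat.zero_le d]
    refine (lift_le b h (ha N)).symm.trans ?_
    rw [hsum, map_mul, map_pow]
    rfl

lemma exists_eq_of_add (hk : 0 < k) (hkn : k < n) (d : ℕ) (b : B k n) :
    ∃ a b', b = of k n a + of k n (Alg.t k n) ^ d * b' := by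
  obtain ⟨a, ha⟩ := exists_lift b (2 * (n * d))
  obtain ⟨b', hb'⟩ := exists_eq_of_t_pow_mul hk hkn d (b - of k n a) (by
    change b.1 _ - Ideal.Quotient.mk (Alg.m k n ^ (2 * (n * d))) a = 0
    rw [ha, sub_self])
  exact ⟨a, b', by rw [← hb']; abel⟩

variable (k n) in
/-- A module over the completed algebra is separated if only zero is divisible by all powers
of `t`. -/
def Separated (M : Type*) [AddCommGroup M] [Module (B k n) M] : Prop :=
  ∀ u : M, (∀ d : ℕ, ∃ v : M, u = of k n (Alg.t k n) ^ d • v) → u = 0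

lemma separated_self : Separated k n (B k n) := by
  intro b hb
  refine Subtype.ext (funext fun N => ?_)
  obtain ⟨c, rfl⟩ := hb N
  change Ideal.Quotient.mk _ (Alg.t k n) ^ N * c.1 N = 0
  rw [← map_pow, (Ideal.Quotient.eq_zero_iff_mem).2 (Ideal.pow_mem_pow Alg.t_mem_m N), zero_mul]

section Linear

variable {M M' : Type*} [AddCommGroup M] [Module (B k n) M] [AddCommGroup M'] [Module (B k n) M']

/-- An additive map into a separated module that commutes with the generators is linear over the
completed algebra. -/
lemma map_smul_of_gen (hk : 0 < k) (hkn : k < n) (hM' : Separated k n M') (s : M →+ M')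
    (hs : ∀ (c : ℂ) u, s (algebraMap ℂ (B k n) c • u) = algebraMap ℂ (B k n) c • s u)
    (he : ∀ i u, s (of k n (Alg.e k i) • u) = of k n (Alg.e k i) • s u)
    (hx : ∀ i u, s (of k n (Alg.x k i) • u) = of k n (Alg.x k i) • s u)
    (hy : ∀ i u, s (of k n (Alg.y k i) • u) = of k n (Alg.y k i) • s u)
    (b : B k n) (u : M) : s (b • u) = b • s u := by
  have h (a : Alg k n) : ∀ u, s (of k n a • u) = of k n a • s u := by
    induction a using Alg.induction with
    | hs c => exact hs c
    | he i => exact he i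
    | hx i => exact hx i
    | hy i => exact hy i
    | hadd a b ha hb => intro u; rw [map_add, add_smul, add_smul, map_add, ha, hb]
    | hmul a b ha hb => intro u; rw [map_mul, mul_smul, mul_smul, ha, hb]
  rw [← sub_eq_zero]
  refine hM' _ fun d => ?_
  obtain ⟨a, b', rfl⟩ := exists_eq_of_add hk hkn d b
  refine ⟨s (b' • u) - b' • s u, ?_⟩
  have h2 (v : M) : s (of k n (Alg.t k n) ^ d • v) = of k n (Alg.t k n) ^ d • s v := by
    rw [← map_pow]; exact h _ v
  rw [add_smul, add_smul, map_add, h, mul_smul, mul_smul, h2, smul_sub]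
  abel

end Linear

end B

namespace RankOne

variable {hk : 0 < k} {hkn : k < n} {I : Rim k n}

instance : SMul (B k n) (RankOne hk hkn I) := inferInstance

instance : DistribMulAction (B k n) (RankOne hk hkn I) := inferInstance

/-- The inclusion of the copy of `ℂ⟦t⟧` at the vertex `i`. -/
def single (hk : 0 < k) (hkn : k < n) (I : Rim k n) (i : ZMod n) : ℂ⟦X⟧ →+ RankOne hk hkn I :=
  AddMonoidHom.single (fun _ : ZMod n => ℂ⟦X⟧) i

/-- The component at the vertex `i`. -/
def proj (hk : 0 < k) (hkn : k < n) (I : Rim k n) (i : ZMod n) : RankOne hk hkn I →+ ℂ⟦X⟧ :=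
  Pi.evalAddMonoidHom (fun _ : ZMod n => ℂ⟦X⟧) i

@[ext] lemma ext {u v : RankOne hk hkn I} (h : ∀ i, proj hk hkn I i u = proj hk hkn I i v) :
    u = v := funext h

lemma proj_single (i j : ZMod n) (f : ℂ⟦X⟧) :
    proj hk hkn I i (single hk hkn I j f) = if i = j then f else 0 :=
  Pi.single_apply j f i

lemma sum_single (u : RankOne hk hkn I) : ∑ i, single hk hkn I i (proj hk hkn I i u) = u :=
  Finset.univ_sum_single (fun i => proj hk hkn I i u)

lemma x_smul_eq (i : ZMod n) (u : RankOne hk hkn I) : B.of k n (Alg.x k i) • u =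
    single hk hkn I i (I.cx i * proj hk hkn I (i - 1) u) := x_smul hk hkn I i u

lemma y_smul_eq (i : ZMod n) (u : RankOne hk hkn I) : B.of k n (Alg.y k i) • u =
    single hk hkn I (i - 1) (I.cy i * proj hk hkn I i u) := y_smul hk hkn I i u

lemma e_smul_eq (i : ZMod n) (u : RankOne hk hkn I) : B.of k n (Alg.e k i) • u =
    single hk hkn I i (proj hk hkn I i u) := e_smul hk hkn I i u

lemma proj_t_smul (i : ZMod n) (u : RankOne hk hkn I) :
    proj hk hkn I i (B.of k n (Alg.t k n) • u) = PowerSeries.X * proj hk hkn I i u := by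
  rw [Alg.t, map_sum, Finset.sum_smul, map_sum, Finset.sum_eq_single i]
  · rw [map_mul, mul_smul, x_smul_eq, y_smul_eq, proj_single, if_pos rfl, proj_single, if_pos rfl,
      ← mul_assoc, I.cx_mul_cy]
  · intro j _ hj
    rw [map_mul, mul_smul, x_smul_eq, proj_single, if_neg hj.symm]
  · exact fun h => absurd (Finset.mem_univ _) h

lemma proj_t_pow_smul (d : ℕ) (i : ZMod n) (u : RankOne hk hkn I) :
    proj hk hkn I i (B.of k n (Alg.t k n) ^ d • u) = PowerSeries.X ^ d * proj hk hkn I i u := by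
  induction d with
  | zero => rw [pow_zero, pow_zero, one_smul, one_mul]
  | succ d ih => rw [pow_succ', mul_smul, proj_t_smul, ih, pow_succ', mul_assoc]

variable (hk hkn I) in
lemma separated : B.Separated k n (RankOne hk hkn I) := by
  intro u hu
  ext1 i
  rw [map_zero]
  refine B.eq_of_forall_dvd fun D => ?_
  obtain ⟨v, rfl⟩ := hu D
  rw [proj_t_pow_smul, sub_zero]
  exact ⟨_, rfl⟩

lemma of_smul_eq (a : Alg k n) (u : RankOne hk hkn I) :
    B.of k n a • u = (show RankOne hk hkn I from I.rep a u) :=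
  B.act_of I.rep (I.isContinuous_rep hk hkn) a u

lemma algebraMap_complex_smul (c : ℂ) (u : RankOne hk hkn I) (i : ZMod n) :
    proj hk hkn I i (algebraMap ℂ (B k n) c • u) = PowerSeries.C c * proj hk hkn I i u := by
  have h : algebraMap ℂ (B k n) c = B.of k n (algebraMap ℂ _ c) := ((B.of k n).commutes c).symm
  rw [h, of_smul_eq, I.rep.commutes]
  exact PowerSeries.smul_eq_C_mul (proj hk hkn I i u) c

lemma exists_eq_add_X_pow_mul (f : ℂ⟦X⟧) (d : ℕ) :
    ∃ (p : Polynomial ℂ) (g : ℂ⟦X⟧), f = (p : ℂ⟦X⟧) + PowerSeries.X ^ d * g := by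
  have h : (PowerSeries.X : ℂ⟦X⟧) ^ d ∣ f - (f.trunc d : Polynomial ℂ) :=
    PowerSeries.X_pow_dvd_iff.2 fun m hm => by
      rw [map_sub, Polynomial.coeff_coe, PowerSeries.coeff_trunc, if_pos hm, sub_self]
  obtain ⟨g, hg⟩ := h
  exact ⟨f.trunc d, g, by rw [← hg]; ring⟩

/-- Power series act on `L_I` by multiplication. -/
lemma proj_algebraMap_smul (f : ℂ⟦X⟧) (u : RankOne hk hkn I) (i : ZMod n) :
    proj hk hkn I i (algebraMap ℂ⟦X⟧ (B k n) f • u) = f * proj hk hkn I i u := by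
  have hp (p : Polynomial ℂ) (u : RankOne hk hkn I) :
      proj hk hkn I i (algebraMap ℂ⟦X⟧ (B k n) p • u) = p * proj hk hkn I i u := by
    induction p using Polynomial.induction_on' with
    | add p q hp hq => rw [Polynomial.coe_add, map_add, add_smul, map_add, hp, hq, add_mul]
    | monomial d c =>
      rw [← Polynomial.C_mul_X_pow_eq_monomial, Polynomial.coe_mul, Polynomial.coe_C,
        Polynomial.coe_pow, Polynomial.coe_X, map_mul, mul_smul, B.algebraMap_C,
        algebraMap_complex_smul, B.algebraMap_X_pow, proj_t_pow_smul, mul_assoc]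
  refine B.eq_of_forall_dvd fun D => ?_
  obtain ⟨p, g, rfl⟩ := exists_eq_add_X_pow_mul f D
  rw [map_add, add_smul, map_add, hp, map_mul, mul_smul, B.algebraMap_X_pow, proj_t_pow_smul]
  exact ⟨proj hk hkn I i (algebraMap ℂ⟦X⟧ (B k n) g • u) - g * proj hk hkn I i u, by ring⟩

lemma algebraMap_smul_single (f g : ℂ⟦X⟧) (i : ZMod n) :
    algebraMap ℂ⟦X⟧ (B k n) f • single hk hkn I i g = single hk hkn I i (f * g) := by
  ext1 j
  rw [proj_algebraMap_smul, proj_single, proj_single]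
  split_ifs <;> simp

section Lift

variable {M : Type*} [AddCommGroup M] [Module (B k n) M]

/-- A family of elements of a module satisfies the relations of the standard generators
of `L_I`. -/
structure Relations (I : Rim k n) (v : ZMod n → M) : Prop where
  e (i) : B.of k n (Alg.e k i) • v i = v i
  x (i) : B.of k n (Alg.x k i) • v (i - 1) = algebraMap ℂ⟦X⟧ (B k n) (I.cx i) • v i
  y (i) : B.of k n (Alg.y k i) • v i = algebraMap ℂ⟦X⟧ (B k n) (I.cy i) • v (i - 1)

lemma Relations.single (hk : 0 < k) (hkn : k < n) (I : Rim k n) :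
    Relations I fun i => single hk hkn I i 1 where
  e i := by rw [e_smul_eq, proj_single, if_pos rfl]
  x i := by rw [x_smul_eq, proj_single, if_pos rfl, algebraMap_smul_single]
  y i := by rw [y_smul_eq, proj_single, if_pos rfl, algebraMap_smul_single]

lemma Relations.map {M' : Type*} [AddCommGroup M'] [Module (B k n) M'] {v : ZMod n → M}
    (hv : Relations I v) (s : M →ₗ[B k n] M') : Relations I fun i => s (v i) where
  e i := by rw [← map_smul, hv.e]
  x i := by rw [← map_smul, hv.x, map_smul]
  y i := by rw [← map_smul, hv.y, map_smul]

lemma Relations.e_ne {v : ZMod n → M} (hv : Relations I v) {i j : ZMod n} (h : i ≠ j) :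
    B.of k n (Alg.e k i) • v j = 0 := by
  rw [← hv.e j, smul_smul, ← map_mul, Alg.e_mul_e_of_ne h, map_zero, zero_smul]

lemma Relations.x_ne {v : ZMod n → M} (hv : Relations I v) {i j : ZMod n} (h : j ≠ i - 1) :
    B.of k n (Alg.x k i) • v j = 0 := by
  rw [← Alg.x_mul_e, map_mul, mul_smul, hv.e_ne h.symm, smul_zero]

lemma Relations.y_ne {v : ZMod n → M} (hv : Relations I v) {i j : ZMod n} (h : j ≠ i) :
    B.of k n (Alg.y k i) • v j = 0 := by
  rw [← Alg.y_mul_e, map_mul, mul_smul, hv.e_ne h.symm, smul_zero]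

variable (hk hkn) in
/-- The `ℂ⟦t⟧`-linear extension of a family indexed by the vertices. -/
def sumHom (I : Rim k n) (v : ZMod n → M) : RankOne hk hkn I →+ M where
  toFun u := ∑ i, algebraMap ℂ⟦X⟧ (B k n) (proj hk hkn I i u) • v i
  map_zero' := by simp
  map_add' u u' := by simp only [map_add, add_smul, Finset.sum_add_distrib]

lemma sumHom_apply (v : ZMod n → M) (u : RankOne hk hkn I) :
    sumHom hk hkn I v u = ∑ i, algebraMap ℂ⟦X⟧ (B k n) (proj hk hkn I i u) • v i := rfl

lemma sumHom_single (v : ZMod n → M) (i : ZMod n) (f : ℂ⟦X⟧) :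
    sumHom hk hkn I v (single hk hkn I i f) = algebraMap ℂ⟦X⟧ (B k n) f • v i := by
  rw [sumHom_apply, Finset.sum_eq_single i]
  · rw [proj_single, if_pos rfl]
  · intro j _ hj
    rw [proj_single, if_neg hj, map_zero, zero_smul]
  · exact fun h => absurd (Finset.mem_univ _) h

lemma smul_algebraMap_comm (b : B k n) (f : ℂ⟦X⟧) (m : M) :
    b • algebraMap ℂ⟦X⟧ (B k n) f • m = algebraMap ℂ⟦X⟧ (B k n) f • b • m := by
  rw [smul_smul, smul_smul, Algebra.commutes]

/-- The universal property of `L_I` among separated modules. -/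
def lift {v : ZMod n → M} (hv : Relations I v) (hk : 0 < k) (hkn : k < n)
    (hM : B.Separated k n M) : RankOne hk hkn I →ₗ[B k n] M where
  __ := sumHom hk hkn I v
  map_smul' := by
    refine B.map_smul_of_gen hk hkn hM (sumHom hk hkn I v) ?_ ?_ ?_ ?_
    · intro c u
      simp only [sumHom_apply, algebraMap_complex_smul, Finset.smul_sum, map_mul, mul_smul,
        B.algebraMap_C]
    · intro i u
      rw [e_smul_eq, sumHom_single, sumHom_apply, Finset.smul_sum, Finset.sum_eq_single i]
      · rw [smul_algebraMap_comm, hv.e]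
      · intro j _ hj
        rw [smul_algebraMap_comm, hv.e_ne hj.symm, smul_zero]
      · exact fun h => absurd (Finset.mem_univ _) h
    · intro i u
      rw [x_smul_eq, sumHom_single, sumHom_apply, Finset.smul_sum,
        Finset.sum_eq_single (i - 1)]
      · rw [smul_algebraMap_comm, hv.x, mul_comm, map_mul, mul_smul]
      · intro j _ hj
        rw [smul_algebraMap_comm, hv.x_ne hj, smul_zero]
      · exact fun h => absurd (Finset.mem_univ _) h
    · intro i u
      rw [y_smul_eq, sumHom_single, sumHom_apply, Finset.smul_sum, Finset.sum_eq_single i]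
      · rw [smul_algebraMap_comm, hv.y, mul_comm, map_mul, mul_smul]
      · intro j _ hj
        rw [smul_algebraMap_comm, hv.y_ne hj, smul_zero]
      · exact fun h => absurd (Finset.mem_univ _) h

lemma lift_single {v : ZMod n → M} (hv : Relations I v) (hM : B.Separated k n M) (i : ZMod n) :
    lift hv hk hkn hM (single hk hkn I i 1) = v i :=
  (sumHom_single v i 1).trans (by rw [map_one, one_smul])

lemma hom_ext {s s' : RankOne hk hkn I →ₗ[B k n] M}
    (h : ∀ i, s (single hk hkn I i 1) = s' (single hk hkn I i 1)) : s = s' := by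
  refine LinearMap.ext fun u => ?_
  rw [← sum_single u, map_sum, map_sum]
  refine Finset.sum_congr rfl fun i _ => ?_
  rw [← mul_one (proj hk hkn I i u), ← algebraMap_smul_single, map_smul, map_smul, h]

end Lift

end RankOne

lemma natCast_injOn : Set.InjOn (fun j : ℕ => (j : ZMod n)) (Finset.range n) := by
  intro a ha b hb h
  exact Nat.ModEq.eq_of_lt_of_lt ((ZMod.natCast_eq_natCast_iff _ _ _).1 h)
    (Finset.mem_range.1 ha) (Finset.mem_range.1 hb)

lemma image_natCast_range : (Finset.range n).image (fun j : ℕ => (j : ZMod n)) = Finset.univ :=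
  Finset.eq_univ_iff_forall.2 fun i => Finset.mem_image.2
    ⟨i.val, Finset.mem_range.2 (ZMod.val_lt i), ZMod.natCast_zmod_val i⟩

@[to_additive]
lemma prod_range_natCast {M : Type*} [CommMonoid M] (f : ZMod n → M) :
    ∏ j ∈ Finset.range n, f j = ∏ i, f i := by
  rw [← image_natCast_range, Finset.prod_image natCast_injOn]

lemma val_sub_one_add_one (i : ZMod n) : (((i - 1).val + 1 : ℕ) : ZMod n) = i := by
  rw [Nat.cast_add, ZMod.natCast_zmod_val, Nat.cast_one, sub_add_cancel]

lemma val_sub_one_lt (i : ZMod n) : (i - 1).val < n := ZMod.val_lt _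

/-- Either the successor of the representative of `i - 1` represents `i`, or `i = 0`. -/
lemma val_eq_or (i : ZMod n) : i.val = (i - 1).val + 1 ∨ i.val = 0 ∧ (i - 1).val + 1 = n := by
  have h : ((i - 1).val + 1) % n = i.val := by
    rw [← ZMod.val_natCast, val_sub_one_add_one]
  rcases Nat.lt_or_ge ((i - 1).val + 1) n with h1 | h1
  · rw [Nat.mod_eq_of_lt h1] at h
    exact Or.inl h.symm
  · have h2 : (i - 1).val + 1 = n := le_antisymm (val_sub_one_lt i) h1
    rw [h2, Nat.mod_self] at h
    exact Or.inr ⟨h.symm, h2⟩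

/-- A periodic function of the representatives has the expected value at `i`. -/
lemma periodic_val {α : Type*} (f : ℕ → α) (hf : f n = f 0) (i : ZMod n) :
    f i.val = f ((i - 1).val + 1) := by
  rcases val_eq_or i with h | ⟨h1, h2⟩
  · rw [h]
  · rw [h1, h2, hf]

namespace Rim

/-- The product of the scalars of the arrows `x` along the path from `m` to `n`. -/
def tail (I : Rim k n) (m : ℕ) : ℂ⟦X⟧ := ∏ j ∈ Finset.Ico m n, I.cx ((j + 1 : ℕ) : ZMod n)

lemma tail_eq (I : Rim k n) {m : ℕ} (h : m < n) :
    I.tail m = I.cx ((m + 1 : ℕ) : ZMod n) * I.tail (m + 1) :=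
  Finset.prod_eq_prod_Ico_succ_bot h _

lemma prod_range_mul_tail (I : Rim k n) {m : ℕ} (h : m ≤ n) :
    (∏ j ∈ Finset.range m, I.cx ((j + 1 : ℕ) : ZMod n)) * I.tail m = PowerSeries.X ^ (n - k) := by
  rw [tail, Finset.prod_range_mul_prod_Ico _ h, ← prod_cx I,
    ← Equiv.prod_comp (Equiv.addRight (1 : ZMod n)) I.cx, ← prod_range_natCast]
  simp

lemma tail_zero (I : Rim k n) : I.tail 0 = PowerSeries.X ^ (n - k) := by
  simpa using I.prod_range_mul_tail (Nat.zero_le n)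

lemma tail_self (I : Rim k n) : I.tail n = 1 := by simp [tail]

end Rim

namespace RankOne

variable {hk : 0 < k} {hkn : k < n} {I : Rim k n}

/-- Multiples of the paths that start at the vertex `0`. -/
def pathElt (I : Rim k n) (m : ℕ) : B k n :=
  algebraMap ℂ⟦X⟧ (B k n) (I.tail m) * B.of k n (Alg.sx k n ^ m * Alg.e k 0)

lemma e_natCast_mul_sx_pow (m : ℕ) :
    Alg.e k (m : ZMod n) * (Alg.sx k n ^ m * Alg.e k 0) = Alg.sx k n ^ m * Alg.e k 0 := by
  induction m with
  | zero => simp [Alg.e_mul_e]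
  | succ m ih =>
    have h : Alg.e k ((m + 1 : ℕ) : ZMod n) * Alg.sx k n = Alg.sx k n * Alg.e k (m : ZMod n) := by
      have := Alg.sx_mul_e (k := k) ((m + 1 : ℕ) : ZMod n)
      rw [Nat.cast_succ, add_sub_cancel_right] at this
      rw [Alg.e_mul_sx, this, Nat.cast_succ]
    rw [pow_succ', mul_assoc, ← mul_assoc (Alg.e k _), h, mul_assoc, ih]

lemma pathElt_n (hkn : k < n) (I : Rim k n) : pathElt I n = pathElt I 0 := by
  rw [pathElt, pathElt, I.tail_self, I.tail_zero, B.algebraMap_X_pow, Alg.sx_pow_n hkn.le,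
    map_one, one_mul, map_mul, map_pow, pow_zero, one_mul]

lemma of_mul_algebraMap (a a' : Alg k n) (f : ℂ⟦X⟧) :
    B.of k n a * (algebraMap ℂ⟦X⟧ (B k n) f * B.of k n a') =
      algebraMap ℂ⟦X⟧ (B k n) f * B.of k n (a * a') := by
  rw [← mul_assoc, ← Algebra.commutes, mul_assoc, map_mul]

lemma e_mul_pathElt (I : Rim k n) (m : ℕ) :
    B.of k n (Alg.e k (m : ZMod n)) * pathElt I m = pathElt I m := by
  rw [pathElt, of_mul_algebraMap, e_natCast_mul_sx_pow]

lemma sx_mul_pathElt (I : Rim k n) {m : ℕ} (h : m < n) : B.of k n (Alg.sx k n) * pathElt I m =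
    algebraMap ℂ⟦X⟧ (B k n) (I.cx ((m + 1 : ℕ) : ZMod n)) * pathElt I (m + 1) := by
  rw [pathElt, pathElt, of_mul_algebraMap, I.tail_eq h, map_mul, ← mul_assoc (Alg.sx k n),
    ← pow_succ', mul_assoc]

lemma sy_mul_pathElt (I : Rim k n) {m : ℕ} (h : m < n) :
    B.of k n (Alg.sy k n) * pathElt I (m + 1) =
      algebraMap ℂ⟦X⟧ (B k n) (I.cy ((m + 1 : ℕ) : ZMod n)) * pathElt I m := by
  rw [pathElt, pathElt, of_mul_algebraMap, I.tail_eq h, pow_succ', mul_assoc (Alg.sx k n),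
    ← mul_assoc (Alg.sy k n), Alg.sy_mul_sx, map_mul (B.of k n), ← B.algebraMap_X, ← mul_assoc,
    ← map_mul, ← mul_assoc, ← map_mul, ← mul_assoc, mul_comm (I.cy _), I.cx_mul_cy, mul_comm]

lemma relations_pathElt (hkn : k < n) (I : Rim k n) :
    Relations I fun i : ZMod n => pathElt I i.val where
  e i := by
    rw [smul_eq_mul]
    have := e_mul_pathElt I i.val
    rwa [ZMod.natCast_zmod_val] at this
  x i := by
    have h1 := e_mul_pathElt I (i - 1).val
    have h2 := sx_mul_pathElt I (val_sub_one_lt i)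
    rw [val_sub_one_add_one] at h2
    rw [ZMod.natCast_zmod_val] at h1
    rw [smul_eq_mul, smul_eq_mul, periodic_val _ (pathElt_n hkn I) i, ← h2, ← Alg.sx_mul_e,
      map_mul, mul_assoc, h1]
  y i := by
    have h1 := e_mul_pathElt I ((i - 1).val + 1)
    have h2 := sy_mul_pathElt I (val_sub_one_lt i)
    rw [val_sub_one_add_one] at h1 h2
    rw [smul_eq_mul, smul_eq_mul, periodic_val _ (pathElt_n hkn I) i, ← h2, ← Alg.sy_mul_e,
      map_mul, mul_assoc, h1]

variable (hk hkn I) in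
/-- A homomorphism from `L_I` to the free module of rank one. -/
def toFree : RankOne hk hkn I →ₗ[B k n] B k n :=
  lift (relations_pathElt hkn I) hk hkn B.separated_self

variable (hk hkn I) in
/-- The homomorphism from the free module of rank one that sends `1` to the generator at the
vertex `0`. -/
def ofFree : B k n →ₗ[B k n] RankOne hk hkn I :=
  LinearMap.toSpanSingleton _ _ (single hk hkn I 0 1)

lemma proj_sx_smul (u : RankOne hk hkn I) (i : ZMod n) :
    proj hk hkn I i (B.of k n (Alg.sx k n) • u) = I.cx i * proj hk hkn I (i - 1) u := by
  rw [Alg.sx, map_sum, Finset.sum_smul, map_sum, Finset.sum_eq_single i]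
  · rw [x_smul_eq, proj_single, if_pos rfl]
  · intro j _ hj
    rw [x_smul_eq, proj_single, if_neg hj.symm]
  · exact fun h => absurd (Finset.mem_univ _) h

lemma sx_smul_single (i : ZMod n) (f : ℂ⟦X⟧) :
    B.of k n (Alg.sx k n) • single hk hkn I i f = single hk hkn I (i + 1) (I.cx (i + 1) * f) := by
  ext1 j
  rw [proj_sx_smul, proj_single, proj_single]
  by_cases h : j = i + 1
  · rw [if_pos h, if_pos (by rw [h, add_sub_cancel_right]), h]
  · rw [if_neg h, if_neg (fun h' => h (by rw [← h', sub_add_cancel])), mul_zero]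

lemma sx_pow_smul_single (m : ℕ) : B.of k n (Alg.sx k n) ^ m • single hk hkn I 0 1 =
    single hk hkn I m (∏ j ∈ Finset.range m, I.cx ((j + 1 : ℕ) : ZMod n)) := by
  induction m with
  | zero => rw [pow_zero, one_smul, Nat.cast_zero, Finset.prod_range_zero]
  | succ m ih =>
    rw [pow_succ', mul_smul, ih, sx_smul_single, Finset.prod_range_succ, mul_comm, Nat.cast_succ]

/-- A power of `t` factors on `L_I` through a free module. -/
lemma ofFree_toFree (u : RankOne hk hkn I) : ofFree hk hkn I (toFree hk hkn I u) =
    algebraMap ℂ⟦X⟧ (B k n) (PowerSeries.X ^ (n - k)) • u := by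
  suffices h : ofFree hk hkn I ∘ₗ toFree hk hkn I = lift
      (v := fun i => single hk hkn I i (PowerSeries.X ^ (n - k)))
      (by
        refine ⟨fun i => ?_, fun i => ?_, fun i => ?_⟩
        · rw [e_smul_eq, proj_single, if_pos rfl]
        · rw [x_smul_eq, proj_single, if_pos rfl, algebraMap_smul_single]
        · rw [y_smul_eq, proj_single, if_pos rfl, algebraMap_smul_single])
      hk hkn (separated hk hkn I) by
    refine (LinearMap.congr_fun h u).trans ((sumHom_apply _ u).trans ?_)
    simp only [algebraMap_smul_single]
    ext1 i
    rw [proj_algebraMap_smul, map_sum, Finset.sum_eq_single i, proj_single, if_pos rfl, mul_comm]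
    · intro j _ hj
      rw [proj_single, if_neg hj.symm]
    · exact fun h => absurd (Finset.mem_univ _) h
  refine hom_ext fun i => ?_
  rw [lift_single, LinearMap.comp_apply, toFree, lift_single, ofFree,
    LinearMap.toSpanSingleton_apply, pathElt, mul_smul, map_mul, mul_smul, e_smul_eq, proj_single,
    if_pos rfl, map_pow, sx_pow_smul_single, algebraMap_smul_single, mul_comm,
    I.prod_range_mul_tail (ZMod.val_lt i).le, ZMod.natCast_zmod_val]

end RankOne

/-! ### Heights -/

section Height

variable (A C : Finset (ZMod n))

/-- The change of the height along the edge `i`: up for `i ∈ A` and down for `i ∈ C`. -/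
def slope (i : ZMod n) : ℤ := (if i ∈ A then 1 else 0) - (if i ∈ C then 1 else 0)

/-- The height of the vertex `i`, relative to the vertex `0`. -/
def height (i : ZMod n) : ℤ := ∑ j ∈ Finset.range i.val, slope A C ((j + 1 : ℕ) : ZMod n)

variable {A C}

lemma sum_slope (h : A.card = C.card) : ∑ i, slope A C i = 0 := by
  simp [slope, Finset.sum_sub_distrib, h]

lemma height_eq (h : A.card = C.card) (i : ZMod n) :
    height A C i = height A C (i - 1) + slope A C i := by
  have hf : ∑ j ∈ Finset.range n, slope A C ((j + 1 : ℕ) : ZMod n) =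
      ∑ j ∈ Finset.range 0, slope A C ((j + 1 : ℕ) : ZMod n) := by
    rw [Finset.sum_range_zero, ← sum_slope h, ← Equiv.sum_comp (Equiv.addRight (1 : ZMod n)),
      ← sum_range_natCast]
    simp
  rw [height, periodic_val (fun m => ∑ j ∈ Finset.range m, slope A C ((j + 1 : ℕ) : ZMod n)) hf,
    Finset.sum_range_succ, val_sub_one_add_one]
  rfl

lemma height_add_one (h : A.card = C.card) (i : ZMod n) :
    height A C (i + 1) = height A C i + slope A C (i + 1) := by
  rw [height_eq h, add_sub_cancel_right]

/-- The scalar `t` on the edges in `A`, and `1` on the others. -/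
def edgeScalar (A : Finset (ZMod n)) (i : ZMod n) : ℂ⟦X⟧ := if i ∈ A then PowerSeries.X else 1

/-- The equation at the edge `i` that a homomorphism between modules of rank one has to satisfy. -/
def edgeDefect (A C : Finset (ZMod n)) (h : ZMod n → ℂ⟦X⟧) (i : ZMod n) : ℂ⟦X⟧ :=
  edgeScalar A i * h (i - 1) - edgeScalar C i * h i

lemma edgeDefect_add_one (h : ZMod n → ℂ⟦X⟧) (i : ZMod n) : edgeDefect A C h (i + 1) =
    edgeScalar A (i + 1) * h i - edgeScalar C (i + 1) * h (i + 1) := by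
  rw [edgeDefect, add_sub_cancel_right]

/-- The defect in terms of heights below a bound `M`. -/
lemma X_pow_mul_sub (hAC : Disjoint A C) (hc : A.card = C.card) (h : ZMod n → ℂ⟦X⟧) (M : ℤ)
    (i : ZMod n) (h0 : height A C i ≤ M) (h1 : height A C (i + 1) ≤ M) :
    edgeDefect A C h (i + 1) ∣
      PowerSeries.X ^ (M - height A C (i + 1)).toNat * h (i + 1) -
        PowerSeries.X ^ (M - height A C i).toNat * h i := by
  rw [edgeDefect_add_one]
  have hh := height_add_one hc i
  by_cases hA : i + 1 ∈ A
  · have hC : i + 1 ∉ C := Finset.disjoint_left.1 hAC hA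
    simp only [slope, hA, hC, if_true, if_false, sub_zero] at hh
    have e : (M - height A C i).toNat = (M - height A C (i + 1)).toNat + 1 := by omega
    rw [edgeScalar, edgeScalar, if_pos hA, if_neg hC, e]
    exact ⟨-PowerSeries.X ^ (M - height A C (i + 1)).toNat, by ring⟩
  · by_cases hC : i + 1 ∈ C
    · simp only [slope, hA, hC, if_true, if_false, zero_sub] at hh
      have e : (M - height A C (i + 1)).toNat = (M - height A C i).toNat + 1 := by omega
      rw [edgeScalar, edgeScalar, if_neg hA, if_pos hC, e]
      exact ⟨-PowerSeries.X ^ (M - height A C i).toNat, by ring⟩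
    · simp only [slope, hA, hC, if_false, sub_zero, add_zero] at hh
      rw [edgeScalar, edgeScalar, if_neg hA, if_neg hC, hh]
      exact ⟨-PowerSeries.X ^ (M - height A C i).toNat, by ring⟩

lemma dvd_along_path (hAC : Disjoint A C) (hc : A.card = C.card) {h : ZMod n → ℂ⟦X⟧} {f : ℂ⟦X⟧}
    (hh : ∀ i, f ∣ edgeDefect A C h i) (M : ℤ) (p : ZMod n) (l : ℕ)
    (hM : ∀ j ≤ l, height A C (p + j) ≤ M) :
    f ∣ PowerSeries.X ^ (M - height A C (p + l)).toNat * h (p + l) -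
      PowerSeries.X ^ (M - height A C p).toNat * h p := by
  induction l with
  | zero => simp
  | succ l ih =>
    have h1 := ih fun j hj => hM j (by omega)
    have h2 := X_pow_mul_sub hAC hc h M (p + l) (hM l (by omega))
      (by simpa [add_assoc] using hM (l + 1) le_rfl)
    have h3 := dvd_add ((hh _).trans h2) h1
    rw [sub_add_sub_cancel] at h3
    simpa [add_assoc] using h3

lemma height_sub_le (hc : A.card = C.card) (p : ZMod n) {a b : ℕ} (hab : a ≤ b) :
    height A C (p + b) - height A C (p + a) ≤
      ((Finset.Ico a b).filter fun j : ℕ => p + (j + 1 : ℕ) ∈ A).card := by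
  induction b, hab using Nat.le_induction with
  | base => simp
  | succ b hab ih =>
    have h := height_add_one hc (p + b)
    rw [← Finset.insert_Ico_right_eq_Ico_add_one hab, Finset.filter_insert]
    have e : p + ((b + 1 : ℕ) : ZMod n) = p + b + 1 := by push_cast; ring
    rw [e]
    have h2 : slope A C (p + b + 1) ≤ if p + b + 1 ∈ A then 1 else 0 := by
      rw [slope]; split_ifs <;> simp
    split_ifs at h2 ⊢
    · rw [Finset.card_insert_of_notMem (by simp), Nat.cast_succ]
      omega
    · omega

/-- If `A` has at most three elements, then one of the two paths between two vertices rises by at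
most one above the higher of them. -/
lemma exists_low_path (hc : A.card = C.card) (h3 : A.card ≤ 3) (p : ZMod n) {l : ℕ}
    (_ : l ≤ n) :
    (∀ j ≤ l, height A C (p + j) ≤ max (height A C p) (height A C (p + l)) + 1) ∨
      (∀ j, l ≤ j → j ≤ n →
        height A C (p + j) ≤ max (height A C p) (height A C (p + l)) + 1) := by
  by_contra! h
  obtain ⟨⟨a, ha, ha'⟩, b, hb, hb', hb''⟩ := h
  have h1 := height_sub_le hc p (Nat.zero_le a)
  have h2 := height_sub_le hc p hb
  rw [Nat.cast_zero, add_zero] at h1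
  set S := (Finset.Ico 0 a).filter fun j : ℕ => p + (j + 1 : ℕ) ∈ A
  set T := (Finset.Ico l b).filter fun j : ℕ => p + (j + 1 : ℕ) ∈ A
  have hST : Disjoint S T := by
    refine Finset.disjoint_left.2 fun j hj hj' => ?_
    have := (Finset.mem_Ico.1 (Finset.mem_filter.1 hj).1).2
    have := (Finset.mem_Ico.1 (Finset.mem_filter.1 hj').1).1
    omega
  have hle : (S ∪ T).card ≤ A.card := by
    refine Finset.card_le_card_of_injOn (fun j : ℕ => p + (j + 1 : ℕ)) ?_ ?_
    · intro j hj
      rcases Finset.mem_union.1 hj with hj | hj <;> exact (Finset.mem_filter.1 hj).2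
    · have hlt : ∀ j ∈ S ∪ T, j ∈ Finset.range n := by
        intro j hj
        rw [Finset.mem_range]
        rcases Finset.mem_union.1 hj with hj | hj
        · have := (Finset.mem_Ico.1 (Finset.mem_filter.1 hj).1).2
          omega
        · have := (Finset.mem_Ico.1 (Finset.mem_filter.1 hj).1).2
          omega
      intro j hj j' hj' e
      refine natCast_injOn (hlt j hj) (hlt j' hj') ?_
      simpa using e
  rw [Finset.card_union_of_disjoint hST] at hle
  have := le_max_left (height A C p) (height A C (p + l))
  have := le_max_right (height A C p) (height A C (p + l))
  omega

/-- A family that satisfies the edge equations modulo `t ^ 2` is determined modulo `t`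
by its value at any lowest vertex. -/
lemma X_dvd_of_height_le (hAC : Disjoint A C) (hc : A.card = C.card) (h3 : A.card ≤ 3)
    {h : ZMod n → ℂ⟦X⟧} (hh : ∀ i, PowerSeries.X ^ 2 ∣ edgeDefect A C h i) {p q : ZMod n}
    (hpq : height A C p ≤ height A C q) :
    PowerSeries.X ∣ h q - PowerSeries.X ^ (height A C q - height A C p).toNat * h p := by
  obtain ⟨l, hl, rfl⟩ : ∃ l : ℕ, l ≤ n ∧ p + l = q :=
    ⟨(q - p).val, (ZMod.val_lt _).le, by simp⟩
  have e1 : (height A C (p + l) + 1 - height A C (p + l)).toNat = 1 := by omega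
  have e2 : (height A C (p + l) + 1 - height A C p).toNat =
      (height A C (p + l) - height A C p).toNat + 1 := by omega
  have key : (PowerSeries.X : ℂ⟦X⟧) ^ 2 ∣ PowerSeries.X * (h (p + l) -
      PowerSeries.X ^ (height A C (p + l) - height A C p).toNat * h p) := by
    rcases exists_low_path hc h3 p hl with H | H
    · rw [max_eq_right hpq] at H
      have := dvd_along_path hAC hc hh _ p l H
      rw [e1, e2] at this
      convert this using 1
      ring
    · rw [max_eq_right hpq] at H
      have := dvd_along_path hAC hc hh (height A C (p + l) + 1) (p + l) (n - l) (fun j hj => by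
        have := H (l + j) (by omega) (by omega)
        rwa [Nat.cast_add, ← add_assoc] at this)
      rw [Nat.cast_sub hl, ZMod.natCast_self, zero_sub, add_neg_cancel_right, e1, e2] at this
      rw [← dvd_neg]
      convert this using 1
      ring
  rw [pow_two] at key
  exact (mul_dvd_mul_iff_left PowerSeries.X_ne_zero).1 key

/-- The generator of the module of solutions of the edge equations, relative to a lowest
vertex `p`. -/
lemma edgeDefect_X_pow (hAC : Disjoint A C) (hc : A.card = C.card) {p : ZMod n}
    (hp : ∀ i, height A C p ≤ height A C i) (i : ZMod n) :
    edgeDefect A C (fun i => PowerSeries.X ^ (height A C i - height A C p).toNat) i = 0 := by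
  rw [edgeDefect, sub_eq_zero]
  have hh := height_eq hc i
  have := hp i
  have := hp (i - 1)
  by_cases hA : i ∈ A
  · have hC : i ∉ C := Finset.disjoint_left.1 hAC hA
    simp only [slope, hA, hC, if_true, if_false, sub_zero] at hh
    rw [edgeScalar, edgeScalar, if_pos hA, if_neg hC, one_mul, ← pow_succ']
    congr 1
    omega
  · by_cases hC : i ∈ C
    · simp only [slope, hA, hC, if_true, if_false, zero_sub] at hh
      rw [edgeScalar, edgeScalar, if_neg hA, if_pos hC, one_mul, ← pow_succ']
      congr 1
      omega
    · simp only [slope, hA, hC, if_false, sub_zero, add_zero] at hh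
      rw [edgeScalar, edgeScalar, if_neg hA, if_neg hC, hh]

lemma exists_lowest (A C : Finset (ZMod n)) : ∃ p, ∀ i, height A C p ≤ height A C i :=
  Finite.exists_min _

end Height

namespace RankOne

variable {hk : 0 < k} {hkn : k < n} {I J : Rim k n}

variable (hk hkn J) in
/-- Multiplication by `t ^ N` on `L_J`. -/
abbrev tPow (N : ℕ) : obj hk hkn J ⟶ obj hk hkn J := (PowerSeries.X ^ N : ℂ⟦X⟧) • 𝟙 _

lemma mem_range_tPow (N : ℕ) (u : RankOne hk hkn J) :
    u ∈ LinearMap.range (tPow hk hkn J N).hom ↔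
      ∀ i, PowerSeries.X ^ N ∣ proj hk hkn J i u := by
  constructor
  · rintro ⟨v, rfl⟩ i
    exact ⟨_, proj_algebraMap_smul _ v i⟩
  · intro h
    choose v hv using h
    refine ⟨(v : ZMod n → ℂ⟦X⟧), ?_⟩
    refine ext fun i => ?_
    rw [hv]
    exact proj_algebraMap_smul _ (show RankOne hk hkn J from v) i

variable (hk hkn J) in
/-- The module `L_J / t ^ N L_J`. -/
abbrev Quot (N : ℕ) : Type :=
  RankOne hk hkn J ⧸ LinearMap.range (tPow hk hkn J N).hom

variable (hk hkn J) in
/-- The quotient map. -/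
abbrev toQuot (N : ℕ) : RankOne hk hkn J →ₗ[B k n] Quot hk hkn J N :=
  Submodule.mkQ _

lemma toQuot_eq_iff {N : ℕ} {u v : RankOne hk hkn J} : toQuot hk hkn J N u = toQuot hk hkn J N v ↔
    ∀ i, PowerSeries.X ^ N ∣ proj hk hkn J i u - proj hk hkn J i v := by
  rw [Submodule.mkQ_apply, Submodule.mkQ_apply, Submodule.Quotient.eq, mem_range_tPow]
  simp only [map_sub]

lemma toQuot_single_eq_iff {N : ℕ} {i : ZMod n} {f g : ℂ⟦X⟧} :
    toQuot hk hkn J N (single hk hkn J i f) = toQuot hk hkn J N (single hk hkn J i g) ↔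
      PowerSeries.X ^ N ∣ f - g := by
  rw [toQuot_eq_iff]
  constructor
  · intro h
    simpa [proj_single] using h i
  · intro h j
    rw [proj_single, proj_single]
    split_ifs
    · exact h
    · simp

variable (hk hkn J) in
lemma separated_quot (N : ℕ) : B.Separated k n (Quot hk hkn J N) := by
  intro u hu
  obtain ⟨v, rfl⟩ := hu N
  obtain ⟨w, rfl⟩ := Submodule.mkQ_surjective _ v
  rw [← map_smul, Submodule.mkQ_apply, Submodule.Quotient.mk_eq_zero, mem_range_tPow]
  intro i
  rw [proj_t_pow_smul]
  exact ⟨_, rfl⟩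

/-- The equations for the arrows at the edge `i` amount to one condition on the defect. -/
lemma dvd_edgeDefect_iff (I J : Rim k n) (f : ℂ⟦X⟧) (h : ZMod n → ℂ⟦X⟧) (i : ZMod n) :
    f ∣ edgeDefect (I.1 \ J.1) (J.1 \ I.1) h i ↔
      f ∣ J.cx i * h (i - 1) - I.cx i * h i ∧ f ∣ J.cy i * h i - I.cy i * h (i - 1) := by
  unfold edgeDefect edgeScalar Rim.cx Rim.cy
  by_cases hI : i ∈ I.1 <;> by_cases hJ : i ∈ J.1 <;>
    simp only [Finset.mem_sdiff, hI, hJ, not_true, not_false_eq_true, and_true, and_false,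
      if_true, if_false, one_mul]
  · refine ⟨fun h' => ⟨h', ?_⟩, fun h' => h'.1⟩
    rw [← mul_sub, ← neg_sub, mul_neg]
    exact (h'.mul_left _).neg_right
  · rw [← neg_sub (h i), dvd_neg, and_self]
  · rw [← neg_sub (_ * h i), dvd_neg, and_self]
  · refine ⟨fun h' => ⟨?_, ?_⟩, fun h' => ?_⟩
    · rw [← mul_sub]
      exact h'.mul_left _
    · rw [← neg_sub]
      exact h'.neg_right
    · rw [← neg_sub]
      exact h'.2.neg_right

lemma relations_toQuot_iff {N : ℕ} {h : ZMod n → ℂ⟦X⟧} :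
    Relations I (fun i => toQuot hk hkn J N (single hk hkn J i (h i))) ↔
      ∀ i, PowerSeries.X ^ N ∣ edgeDefect (I.1 \ J.1) (J.1 \ I.1) h i := by
  have hx (i : ZMod n) :
      B.of k n (Alg.x k i) • toQuot hk hkn J N (single hk hkn J (i - 1) (h (i - 1))) =
        algebraMap ℂ⟦X⟧ (B k n) (I.cx i) • toQuot hk hkn J N (single hk hkn J i (h i)) ↔
      PowerSeries.X ^ N ∣ J.cx i * h (i - 1) - I.cx i * h i := by
    rw [← (toQuot hk hkn J N).map_smul, ← (toQuot hk hkn J N).map_smul, x_smul_eq, proj_single, if_pos rfl, algebraMap_smul_single,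
      toQuot_single_eq_iff]
  have hy (i : ZMod n) :
      B.of k n (Alg.y k i) • toQuot hk hkn J N (single hk hkn J i (h i)) =
        algebraMap ℂ⟦X⟧ (B k n) (I.cy i) •
          toQuot hk hkn J N (single hk hkn J (i - 1) (h (i - 1))) ↔
      PowerSeries.X ^ N ∣ J.cy i * h i - I.cy i * h (i - 1) := by
    rw [← (toQuot hk hkn J N).map_smul, ← (toQuot hk hkn J N).map_smul, y_smul_eq, proj_single, if_pos rfl, algebraMap_smul_single,
      toQuot_single_eq_iff]
  constructor
  · exact fun h i => (dvd_edgeDefect_iff I J _ _ i).2 ⟨(hx i).1 (h.x i), (hy i).1 (h.y i)⟩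
  · intro H
    have H (i) := (dvd_edgeDefect_iff I J _ _ i).1 (H i)
    refine ⟨fun i => ?_, fun i => (hx i).2 (H i).1, fun i => (hy i).2 (H i).2⟩
    rw [← (toQuot hk hkn J N).map_smul, e_smul_eq, proj_single, if_pos rfl]

lemma relations_single_iff {h : ZMod n → ℂ⟦X⟧} :
    Relations I (fun i => single hk hkn J i (h i)) ↔
      ∀ i, edgeDefect (I.1 \ J.1) (J.1 \ I.1) h i = 0 := by
  have hs (i : ZMod n) (f g : ℂ⟦X⟧) :
      single hk hkn J i f = single hk hkn J i g ↔ 0 ∣ f - g := by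
    rw [zero_dvd_iff, sub_eq_zero]
    refine ⟨fun h => ?_, fun h => by rw [h]⟩
    have := congrArg (proj hk hkn J i) h
    rwa [proj_single, proj_single, if_pos rfl, if_pos rfl] at this
  constructor
  · intro H i
    rw [← zero_dvd_iff, dvd_edgeDefect_iff, ← hs, ← hs]
    have hx := H.x i
    have hy := H.y i
    rw [x_smul_eq, proj_single, if_pos rfl, algebraMap_smul_single] at hx
    rw [y_smul_eq, proj_single, if_pos rfl, algebraMap_smul_single] at hy
    exact ⟨hx, hy⟩
  · intro H
    have H (i) := (dvd_edgeDefect_iff I J _ _ i).1 (zero_dvd_iff.2 (H i))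
    refine ⟨fun i => ?_, fun i => ?_, fun i => ?_⟩
    · rw [e_smul_eq, proj_single, if_pos rfl]
    · rw [x_smul_eq, proj_single, if_pos rfl, algebraMap_smul_single, hs]
      exact (H i).1
    · rw [y_smul_eq, proj_single, if_pos rfl, algebraMap_smul_single, hs]
      exact (H i).2

/-- A homomorphism from `L_I` to `L_J / t ^ N L_J` is given by a diagonal matrix. -/
lemma exists_diagonal {N : ℕ} (s : RankOne hk hkn I →ₗ[B k n] Quot hk hkn J N) :
    ∃ h : ZMod n → ℂ⟦X⟧, (∀ i, s (single hk hkn I i 1) =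
        toQuot hk hkn J N (single hk hkn J i (h i))) ∧
      ∀ i, PowerSeries.X ^ N ∣ edgeDefect (I.1 \ J.1) (J.1 \ I.1) h i := by
  choose u hu using fun i => Submodule.mkQ_surjective _ (s (single hk hkn I i 1))
  have key (i) : s (single hk hkn I i 1) =
      toQuot hk hkn J N (single hk hkn J i (proj hk hkn J i (u i))) := by
    rw [← e_smul_eq, map_smul, toQuot, hu, ← map_smul, e_smul_eq, proj_single, if_pos rfl]
  refine ⟨fun i => proj hk hkn J i (u i), key, (relations_toQuot_iff (hk := hk) (hkn := hkn)).1 ?_⟩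
  have := (Relations.single hk hkn I).map s
  simpa only [key] using this

end RankOne

/-! ### Extensions and multiplication by central elements -/

section Abelian

open Abelian

variable {R D : Type*} [CommRing R] [Category* D] [Abelian D] [Linear R D] [HasExt.{0} D]

lemma smul_eq_mk₀_comp {X Y : D} {m : ℕ} (r : R) (e : Ext.{0} X Y m) :
    r • e = (Ext.mk₀ (r • 𝟙 X)).comp e (zero_add m) := by
  rw [Ext.mk₀_smul, Ext.smul_comp, Ext.mk₀_id_comp]

lemma smul_eq_zero_of_factor {X P Y : D} [Projective P] (r : R) (s : X ⟶ P) (q : P ⟶ X)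
    (h : s ≫ q = r • 𝟙 X) (e : Ext.{0} X Y 1) : r • e = 0 := by
  rw [smul_eq_mk₀_comp, ← h, ← Ext.mk₀_comp_mk₀, Ext.comp_assoc_of_second_deg_zero,
    Ext.eq_zero_of_projective ((Ext.mk₀ q).comp e (zero_add 1)), Ext.comp_zero]

variable {X Y Q : D} {r : R} {g : Y ⟶ Q} {w : (r • 𝟙 Y) ≫ g = 0}

lemma exists_mk₀_comp_extClass (hS : (ShortComplex.mk (r • 𝟙 Y) g w).ShortExact)
    (e : Ext.{0} X Y 1) (he : r • e = 0) :
    ∃ f : X ⟶ Q, (Ext.mk₀ f).comp hS.extClass (zero_add 1) = e := by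
  rw [Ext.smul_eq_comp_mk₀] at he
  obtain ⟨x, hx⟩ := Ext.covariant_sequence_exact₁ X hS e he (zero_add 1)
  exact ⟨Ext.addEquiv₀ x, by rw [Ext.mk₀_addEquiv₀_apply]; exact hx⟩

lemma mk₀_comp_extClass_eq_zero_iff (hS : (ShortComplex.mk (r • 𝟙 Y) g w).ShortExact)
    (f : X ⟶ Q) :
    (Ext.mk₀ f).comp hS.extClass (zero_add 1) = 0 ↔ ∃ f' : X ⟶ Y, f' ≫ g = f := by
  constructor
  · intro h
    obtain ⟨x, hx⟩ := Ext.covariant_sequence_exact₃ X hS (Ext.mk₀ f) (zero_add 1) h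
    refine ⟨Ext.addEquiv₀ x, Ext.addEquiv₀.symm.injective ?_⟩
    change Ext.mk₀ _ = Ext.mk₀ _
    rw [← Ext.mk₀_comp_mk₀, Ext.mk₀_addEquiv₀_apply]
    exact hx
  · rintro ⟨f', rfl⟩
    rw [← Ext.mk₀_comp_mk₀, Ext.comp_assoc_of_second_deg_zero]
    exact (congrArg (fun y => (Ext.mk₀ f').comp y (zero_add 1)) hS.comp_extClass).trans
      (Ext.comp_zero _ _ _ _ _)

end Abelian

namespace RankOne

open Abelian

variable {hk : 0 < k} {hkn : k < n} {I J : Rim k n}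

lemma X_pow_smul_ext_eq_zero (e : Ext1 hk hkn I J) :
    (PowerSeries.X ^ (n - k) : ℂ⟦X⟧) • e = 0 := by
  have : Projective (ModuleCat.of (B k n) (B k n)) :=
    ModuleCat.projective_of_categoryTheory_projective _
  refine smul_eq_zero_of_factor (P := ModuleCat.of (B k n) (B k n)) _
    (ModuleCat.ofHom (toFree hk hkn I)) (ModuleCat.ofHom (ofFree hk hkn I)) ?_ e
  exact ModuleCat.hom_ext (LinearMap.ext ofFree_toFree)

lemma tPow_toQuot (N : ℕ) : tPow hk hkn J N ≫ ModuleCat.ofHom (toQuot hk hkn J N) = 0 := by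
  exact ModuleCat.hom_ext (LinearMap.ext fun u => (Submodule.Quotient.mk_eq_zero _).2 ⟨u, rfl⟩)

lemma tPow_injective (N : ℕ) : Function.Injective (tPow hk hkn J N).hom := by
  intro u v h
  refine ext (hk := hk) (hkn := hkn) (I := J) fun i => mul_left_cancel₀ (pow_ne_zero N PowerSeries.X_ne_zero) ?_
  rw [← proj_algebraMap_smul, ← proj_algebraMap_smul]
  exact congrArg (proj hk hkn J i) h

variable (hk hkn J) in
lemma shortExact (N : ℕ) : (ShortComplex.mk (tPow hk hkn J N)
    (ModuleCat.ofHom (toQuot hk hkn J N)) (tPow_toQuot N)).ShortExact where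
  exact := by
    rw [ShortComplex.ShortExact.moduleCat_exact_iff_function_exact]
    exact LinearMap.exact_map_mkQ_range _
  mono_f := by
    rw [ModuleCat.mono_iff_injective]
    exact tPow_injective N
  epi_g := by
    rw [ModuleCat.epi_iff_surjective]
    exact Submodule.mkQ_surjective _

end RankOne

section Flat

variable (A C : Finset (ZMod n))

/-- The complex solutions of the edge equations modulo `t`. -/
def flatSections : Submodule ℂ (ZMod n → ℂ) where
  carrier := {h | ∀ i, (i ∈ A → h i = 0) ∧ (i ∈ C → h (i - 1) = 0) ∧
    (i ∉ A → i ∉ C → h (i - 1) = h i)}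
  zero_mem' i := by simp
  add_mem' := fun {a b} ha hb i => by
    refine ⟨fun h => ?_, fun h => ?_, fun h h' => ?_⟩
    · rw [Pi.add_apply, (ha i).1 h, (hb i).1 h, add_zero]
    · rw [Pi.add_apply, (ha i).2.1 h, (hb i).2.1 h, add_zero]
    · rw [Pi.add_apply, Pi.add_apply, (ha i).2.2 h h', (hb i).2.2 h h']
  smul_mem' := fun c a ha i => by
    refine ⟨fun h => ?_, fun h => ?_, fun h h' => ?_⟩
    · rw [Pi.smul_apply, (ha i).1 h, smul_zero]
    · rw [Pi.smul_apply, (ha i).2.1 h, smul_zero]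
    · rw [Pi.smul_apply, Pi.smul_apply, (ha i).2.2 h h']

variable {A C}

lemma X_dvd_sub_iff (f g : ℂ⟦X⟧) : PowerSeries.X ∣ f - g ↔
    PowerSeries.constantCoeff f = PowerSeries.constantCoeff g := by
  rw [PowerSeries.X_dvd_iff, map_sub, sub_eq_zero]

lemma mem_flatSections_iff (hAC : Disjoint A C) (h : ZMod n → ℂ⟦X⟧) :
    (fun i => PowerSeries.constantCoeff (h i)) ∈ flatSections A C ↔
      ∀ i, PowerSeries.X ∣ edgeDefect A C h i := by
  refine forall_congr' fun i => ?_
  rw [edgeDefect, X_dvd_sub_iff, map_mul, map_mul, edgeScalar, edgeScalar]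
  by_cases hA : i ∈ A
  · have hC : i ∉ C := Finset.disjoint_left.1 hAC hA
    simp [hA, hC, eq_comm]
  · by_cases hC : i ∈ C <;> simp [hA, hC]

lemma edgeDefect_mul_const (h : ZMod n → ℂ⟦X⟧) (c : ℂ⟦X⟧) (i : ZMod n) :
    edgeDefect A C (fun i => h i * c) i = edgeDefect A C h i * c := by
  rw [edgeDefect, edgeDefect]; ring

end Flat

namespace Rim

variable (I J : Rim k n)

lemma disjoint_sdiff_sdiff : Disjoint (I.1 \ J.1) (J.1 \ I.1) := by
  exact _root_.disjoint_sdiff_sdiff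

lemma card_sdiff_eq : (I.1 \ J.1).card = (J.1 \ I.1).card :=
  Finset.card_sdiff_comm (I.2.trans J.2.symm)

lemma card_sdiff_le : (I.1 \ J.1).card ≤ k :=
  (Finset.card_le_card Finset.sdiff_subset).trans_eq I.2

end Rim

namespace RankOne

open Abelian

variable {hk : 0 < k} {hkn : k < n} {I J : Rim k n}

lemma X_smul_ext_of_sq (h3 : (I.1 \ J.1).card ≤ 3) (e : Ext1 hk hkn I J)
    (he : (PowerSeries.X ^ 2 : ℂ⟦X⟧) • e = 0) : (PowerSeries.X : ℂ⟦X⟧) • e = 0 := by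
  obtain ⟨f, rfl⟩ := exists_mk₀_comp_extClass (shortExact hk hkn J 2) e he
  rw [← Ext.smul_comp, ← Ext.mk₀_smul, mk₀_comp_extClass_eq_zero_iff]
  obtain ⟨h, hf, hh⟩ := exists_diagonal f.hom
  obtain ⟨p, hp⟩ := exists_lowest (I.1 \ J.1) (J.1 \ I.1)
  have hg := (relations_single_iff (hk := hk) (hkn := hkn) (I := I) (J := J)
    (h := fun i => PowerSeries.X ^ (height (I.1 \ J.1) (J.1 \ I.1) i -
      height (I.1 \ J.1) (J.1 \ I.1) p).toNat * (PowerSeries.X * h p))).2 fun i => by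
    rw [edgeDefect_mul_const, edgeDefect_X_pow (I.disjoint_sdiff_sdiff J) (I.card_sdiff_eq J) hp,
      zero_mul]
  refine ⟨ModuleCat.ofHom (lift hg hk hkn (separated hk hkn J)),
    ModuleCat.hom_ext (hom_ext fun i => ?_)⟩
  have h1 : toQuot hk hkn J 2 (lift hg hk hkn (separated hk hkn J) (single hk hkn I i 1)) =
      algebraMap ℂ⟦X⟧ (B k n) PowerSeries.X • f.hom (single hk hkn I i 1) := by
    rw [lift_single, hf, ← (toQuot hk hkn J 2).map_smul, algebraMap_smul_single,
      toQuot_single_eq_iff]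
    have h2 := X_dvd_of_height_le (I.disjoint_sdiff_sdiff J) (I.card_sdiff_eq J) h3 hh (hp i)
    have h4 := mul_dvd_mul_left (-PowerSeries.X) h2
    rw [neg_mul, neg_dvd, ← pow_two] at h4
    convert h4 using 1
    ring
  exact h1

lemma X_smul_ext_eq_zero (h3 : (I.1 \ J.1).card ≤ 3) (e : Ext1 hk hkn I J) :
    (PowerSeries.X : ℂ⟦X⟧) • e = 0 := by
  have key (N : ℕ) : ∀ e : Ext1 hk hkn I J,
      (PowerSeries.X ^ (N + 1) : ℂ⟦X⟧) • e = 0 → (PowerSeries.X : ℂ⟦X⟧) • e = 0 := by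
    induction N with
    | zero => intro e he; rwa [zero_add, pow_one] at he
    | succ N ih =>
      intro e he
      refine ih e ?_
      rw [pow_succ', mul_smul]
      refine X_smul_ext_of_sq h3 _ ?_
      rw [← mul_smul, ← pow_add, add_comm]
      exact he
  refine key (n - k - 1) e ?_
  rw [Nat.sub_add_cancel (by omega)]
  exact X_pow_smul_ext_eq_zero e

lemma relations_of_mem {h : ZMod n → ℂ} (hh : h ∈ flatSections (I.1 \ J.1) (J.1 \ I.1)) :
    Relations I fun i => toQuot hk hkn J 1 (single hk hkn J i (PowerSeries.C (h i))) := by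
  rw [relations_toQuot_iff, pow_one, ← mem_flatSections_iff (I.disjoint_sdiff_sdiff J)]
  simpa using hh

lemma hom_complex_smul {M N : ModuleCat.{0} (B k n)} (c : ℂ) (f : M ⟶ N) (u : M) :
    (c • f).hom u = algebraMap ℂ (B k n) c • f.hom u := rfl

lemma complex_smul_ofHom_apply {s : RankOne hk hkn I →ₗ[B k n] Quot hk hkn J 1} (c : ℂ)
    {u : RankOne hk hkn I} {v : Quot hk hkn J 1} (h : s u = v) :
    (c • (ModuleCat.ofHom s : obj hk hkn I ⟶ ModuleCat.of (B k n) (Quot hk hkn J 1))).hom u =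
      algebraMap ℂ (B k n) c • v := by
  subst h
  exact hom_complex_smul _ _ _

variable (hk hkn) in
/-- The homomorphism from `L_I` to `L_J / t L_J` with given entries. -/
def diagonal {h : ZMod n → ℂ} (hh : h ∈ flatSections (I.1 \ J.1) (J.1 \ I.1)) :
    RankOne hk hkn I →ₗ[B k n] Quot hk hkn J 1 :=
  lift (relations_of_mem hh) hk hkn (separated_quot hk hkn J 1)

lemma diagonal_single {h : ZMod n → ℂ} (hh : h ∈ flatSections (I.1 \ J.1) (J.1 \ I.1))
    (i : ZMod n) : diagonal hk hkn hh (single hk hkn I i 1) =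
      toQuot hk hkn J 1 (single hk hkn J i (PowerSeries.C (h i))) :=
  lift_single (relations_of_mem hh) (separated_quot hk hkn J 1) i

lemma diagonal_add_single {h h' : ZMod n → ℂ}
    (hh : h ∈ flatSections (I.1 \ J.1) (J.1 \ I.1))
    (hh' : h' ∈ flatSections (I.1 \ J.1) (J.1 \ I.1)) (i : ZMod n) :
    diagonal hk hkn (add_mem hh hh') (single hk hkn I i 1) =
      diagonal hk hkn hh (single hk hkn I i 1) + diagonal hk hkn hh' (single hk hkn I i 1) := by
  rw [diagonal_single, diagonal_single, diagonal_single, Pi.add_apply, map_add, map_add, map_add]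

lemma diagonal_smul_single {h : ZMod n → ℂ}
    (hh : h ∈ flatSections (I.1 \ J.1) (J.1 \ I.1)) (c : ℂ) (i : ZMod n) :
    diagonal hk hkn (Submodule.smul_mem _ c hh) (single hk hkn I i 1) =
      algebraMap ℂ (B k n) c • diagonal hk hkn hh (single hk hkn I i 1) := by
  rw [diagonal_single, diagonal_single, Pi.smul_apply, smul_eq_mul, map_mul,
    ← algebraMap_smul_single, (toQuot hk hkn J 1).map_smul, B.algebraMap_C]

variable (hk hkn I J) in
/-- The homomorphisms from `L_I` to `L_J / t L_J` with given entries, as a linear map. -/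
def homOfFlat : flatSections (I.1 \ J.1) (J.1 \ I.1) →ₗ[ℂ]
    (obj hk hkn I ⟶ ModuleCat.of (B k n) (Quot hk hkn J 1)) where
  toFun h := ModuleCat.ofHom (diagonal hk hkn h.2)
  map_add' h h' := ModuleCat.hom_ext (hom_ext (diagonal_add_single h.2 h'.2))
  map_smul' c h := ModuleCat.hom_ext (hom_ext fun i =>
    (diagonal_smul_single h.2 c i).trans (complex_smul_ofHom_apply c rfl).symm)

lemma homOfFlat_single (h : flatSections (I.1 \ J.1) (J.1 \ I.1)) (i : ZMod n) :
    (homOfFlat hk hkn I J h).hom (single hk hkn I i 1) =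
      toQuot hk hkn J 1 (single hk hkn J i (PowerSeries.C (h.1 i))) :=
  diagonal_single h.2 i

lemma homOfFlat_surjective : Function.Surjective (homOfFlat hk hkn I J) := by
  intro f
  obtain ⟨h, hf, hh⟩ := exists_diagonal f.hom
  rw [pow_one, ← mem_flatSections_iff (I.disjoint_sdiff_sdiff J)] at hh
  refine ⟨⟨_, hh⟩, ModuleCat.hom_ext (hom_ext fun i => ?_)⟩
  rw [homOfFlat_single]
  refine Eq.trans ?_ (hf i).symm
  rw [toQuot_single_eq_iff, pow_one, X_dvd_sub_iff, PowerSeries.constantCoeff_C]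

variable (hk hkn I J) in
/-- The connecting map from the homomorphisms `L_I → L_J / t L_J` to the extensions. -/
def extOfFlat : flatSections (I.1 \ J.1) (J.1 \ I.1) →ₗ[ℂ] Ext1 hk hkn I J :=
  (Ext.postcompOfLinear (shortExact hk hkn J 1).extClass ℂ (obj hk hkn I) (zero_add 1)) ∘ₗ
    (Ext.linearEquiv₀ (R := ℂ)).symm.toLinearMap ∘ₗ homOfFlat hk hkn I J

lemma extOfFlat_apply (h : flatSections (I.1 \ J.1) (J.1 \ I.1)) : extOfFlat hk hkn I J h =
    (Ext.mk₀ (homOfFlat hk hkn I J h)).comp (shortExact hk hkn J 1).extClass (zero_add 1) := rfl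

lemma extOfFlat_surjective (h3 : (I.1 \ J.1).card ≤ 3) :
    Function.Surjective (extOfFlat hk hkn I J) := by
  intro e
  obtain ⟨f, rfl⟩ := exists_mk₀_comp_extClass (shortExact hk hkn J 1) e (by
    rw [pow_one]; exact X_smul_ext_eq_zero h3 e)
  obtain ⟨h, rfl⟩ := homOfFlat_surjective f
  exact ⟨h, rfl⟩

/-- The kernel of the connecting map consists of the multiples of the indicator function of the
lowest vertices. -/
lemma extOfFlat_eq_zero_iff (h3 : (I.1 \ J.1).card ≤ 3) {p : ZMod n}
    (hp : ∀ i, height (I.1 \ J.1) (J.1 \ I.1) p ≤ height (I.1 \ J.1) (J.1 \ I.1) i)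
    (h : flatSections (I.1 \ J.1) (J.1 \ I.1)) : extOfFlat hk hkn I J h = 0 ↔
      ∀ i, h.1 i = if height (I.1 \ J.1) (J.1 \ I.1) i = height (I.1 \ J.1) (J.1 \ I.1) p
        then h.1 p else 0 := by
  set w := height (I.1 \ J.1) (J.1 \ I.1)
  have hcoeff (i : ZMod n) (f : ℂ⟦X⟧) :
      PowerSeries.constantCoeff (PowerSeries.X ^ (w i - w p).toNat * f) =
        if w i = w p then PowerSeries.constantCoeff f else 0 := by
    have := hp i
    split_ifs with hi
    · simp [hi]
    · have : (w i - w p).toNat ≠ 0 := by omega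
      simp [this]
  rw [extOfFlat_apply, mk₀_comp_extClass_eq_zero_iff]
  constructor
  · rintro ⟨f, hf⟩ i
    obtain ⟨g, hg, hg'⟩ : ∃ g : ZMod n → ℂ⟦X⟧,
        (∀ i, f.hom (single hk hkn I i 1) = single hk hkn J i (g i)) ∧
          ∀ i, edgeDefect (I.1 \ J.1) (J.1 \ I.1) g i = 0 := by
      have key (i) : f.hom (single hk hkn I i 1) =
          single hk hkn J i (proj hk hkn J i (f.hom (single hk hkn I i 1))) := by
        rw [← e_smul_eq, ← f.hom.map_smul, e_smul_eq, proj_single, if_pos rfl]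
      refine ⟨_, key, (relations_single_iff (hk := hk) (hkn := hkn)).1 ?_⟩
      have := (Relations.single hk hkn I).map f.hom
      simpa only [← key] using this
    have hfg (i) : h.1 i = PowerSeries.constantCoeff (g i) := by
      have h1 : toQuot hk hkn J 1 (f.hom (single hk hkn I i 1)) =
          (homOfFlat hk hkn I J h).hom (single hk hkn I i 1) := by rw [← hf]; rfl
      rw [hg, homOfFlat_single, toQuot_single_eq_iff, pow_one, X_dvd_sub_iff,
        PowerSeries.constantCoeff_C] at h1
      exact h1.symm
    have h1 := X_dvd_of_height_le (I.disjoint_sdiff_sdiff J) (I.card_sdiff_eq J) h3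
      (fun i => by rw [hg']; exact dvd_zero _) (hp i)
    rw [X_dvd_sub_iff, hcoeff, ← hfg, ← hfg] at h1
    exact h1
  · intro hh
    have hg := (relations_single_iff (hk := hk) (hkn := hkn) (I := I) (J := J)
      (h := fun i => PowerSeries.X ^ (w i - w p).toNat * PowerSeries.C (h.1 p))).2 fun i => by
      rw [edgeDefect_mul_const,
        edgeDefect_X_pow (I.disjoint_sdiff_sdiff J) (I.card_sdiff_eq J) hp, zero_mul]
    refine ⟨ModuleCat.ofHom (lift hg hk hkn (separated hk hkn J)),
      ModuleCat.hom_ext (hom_ext fun i => ?_)⟩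
    rw [homOfFlat_single]
    refine (congrArg (toQuot hk hkn J 1) (lift_single hg (separated hk hkn J) i)).trans ?_
    rw [toQuot_single_eq_iff, pow_one, X_dvd_sub_iff, hcoeff, PowerSeries.constantCoeff_C,
      PowerSeries.constantCoeff_C, ← hh]

end RankOne

section Valley

variable {A C : Finset (ZMod n)}

/-- The edge `i` lies in `A`, and the last edge before it in `A ∪ C` lies in `C`
and precedes `i` by `l + 1`. -/
structure EndsValley (A C : Finset (ZMod n)) (i : ZMod n) (l : ℕ) : Prop where
  mem : i ∈ A
  mem_start : i - (l + 1 : ℕ) ∈ C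
  notMem_left (m) (_ : m < l) : i - (m + 1 : ℕ) ∉ A
  notMem_right (m) (_ : m < l) : i - (m + 1 : ℕ) ∉ C

variable (A C) in
open Classical in
/-- The edges at which a valley ends. -/
def valleys : Finset (ZMod n) := A.filter fun i => ∃ l, EndsValley A C i l

lemma mem_valleys {i : ZMod n} : i ∈ valleys A C ↔ ∃ l, EndsValley A C i l := by
  classical
  rw [valleys, Finset.mem_filter]
  exact ⟨fun h => h.2, fun h => ⟨h.choose_spec.mem, h⟩⟩

lemma valleys_subset : valleys A C ⊆ A := by
  classical exact Finset.filter_subset _ _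

open Classical in
/-- The indicator function of the vertices of a valley. -/
def valleySection (i : ZMod n) (l : ℕ) (j : ZMod n) : ℂ :=
  if ∃ m ≤ l, j = i - (m + 1 : ℕ) then 1 else 0

lemma EndsValley.notMem_of_le (hAC : Disjoint A C) {i : ZMod n} {l : ℕ} (h : EndsValley A C i l)
    {m : ℕ} (hm : m ≤ l) : i - (m + 1 : ℕ) ∉ A := by
  rcases hm.lt_or_eq with hm | rfl
  · exact h.notMem_left m hm
  · exact Finset.disjoint_right.1 hAC h.mem_start

lemma EndsValley.valleySection_mem (hAC : Disjoint A C) {i : ZMod n} {l : ℕ}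
    (h : EndsValley A C i l) : valleySection i l ∈ flatSections A C := by
  have hpred {j : ZMod n} {m : ℕ} (e : j - 1 = i - (m + 1 : ℕ)) : j = i - (m : ℕ) := by
    rw [← sub_add_cancel j 1, e]; push_cast; ring
  refine fun j => ⟨fun hj => if_neg ?_, fun hj => if_neg ?_, fun hjA hjC => ?_⟩
  · rintro ⟨m, hm, rfl⟩
    exact h.notMem_of_le hAC hm hj
  · rintro ⟨m, hm, e⟩
    rw [hpred e] at hj
    rcases m with _ | m
    · rw [Nat.cast_zero, sub_zero] at hj
      exact Finset.disjoint_left.1 hAC h.mem hj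
    · exact h.notMem_right m (by omega) hj
  · refine if_congr ⟨?_, ?_⟩ rfl rfl
    · rintro ⟨m, hm, e⟩
      have e := hpred e
      rcases m with _ | m
      · rw [Nat.cast_zero, sub_zero] at e
        exact absurd (e ▸ h.mem) hjA
      · exact ⟨m, by omega, e⟩
    · rintro ⟨m, hm, rfl⟩
      rcases hm.lt_or_eq with hm | rfl
      · exact ⟨m + 1, hm, by push_cast; ring⟩
      · exact absurd h.mem_start hjC

lemma EndsValley.valleySection_apply {i : ZMod n} {l : ℕ}
    (h : EndsValley A C i l) {i' : ZMod n} (hi' : i' ∈ A) :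
    valleySection i l (i' - 1) = if i' = i then 1 else 0 := by
  refine if_congr ⟨?_, ?_⟩ rfl rfl
  · rintro ⟨m, hm, e⟩
    have e : i' = i - (m : ℕ) := by rw [← sub_add_cancel i' 1, e]; push_cast; ring
    rcases m with _ | m
    · rw [e, Nat.cast_zero, sub_zero]
    · exact absurd (e ▸ hi') (h.notMem_left m (by omega))
  · rintro rfl
    exact ⟨0, Nat.zero_le _, by simp⟩

variable (A C) in
/-- Evaluation at the last vertices of the valleys. -/
def evalValleys : flatSections A C →ₗ[ℂ] (valleys A C → ℂ) :=
  LinearMap.funLeft ℂ ℂ (fun i : valleys A C => i.1 - 1) ∘ₗ (flatSections A C).subtype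

lemma evalValleys_surjective (hAC : Disjoint A C) : Function.Surjective (evalValleys A C) := by
  classical
  choose l hl using fun i : valleys A C => mem_valleys.1 i.2
  intro f
  refine ⟨∑ i, f i • ⟨_, (hl i).valleySection_mem hAC⟩, ?_⟩
  funext i'
  rw [map_sum, Finset.sum_apply, Finset.sum_eq_single i']
  · change f i' * valleySection i'.1 (l i') (i'.1 - 1) = f i'
    rw [(hl i').valleySection_apply (valleys_subset i'.2), if_pos rfl, mul_one]
  · intro i _ hi
    change f i * valleySection i.1 (l i) (i'.1 - 1) = 0
    rw [(hl i).valleySection_apply (valleys_subset i'.2),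
      if_neg (fun h => hi (Subtype.ext h.symm)), mul_zero]
  · exact fun h => absurd (Finset.mem_univ _) h

lemma flatSections_const_right {h : ZMod n → ℂ} (hh : h ∈ flatSections A C) (j : ZMod n) (m : ℕ)
    (hm : ∀ m' < m, j + (m' + 1 : ℕ) ∉ A ∧ j + (m' + 1 : ℕ) ∉ C) : h (j + m) = h j := by
  induction m with
  | zero => simp
  | succ m ih =>
    rw [← ih fun m' hm' => hm m' (by omega)]
    have h1 := (hh (j + (m + 1 : ℕ))).2.2 (hm m (by omega)).1 (hm m (by omega)).2
    rw [← h1]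
    congr 1
    push_cast
    ring

lemma exists_next (hA : A.Nonempty) (C : Finset (ZMod n)) (j : ZMod n) :
    ∃ m : ℕ, (j + (m + 1 : ℕ) ∈ A ∨ j + (m + 1 : ℕ) ∈ C) ∧
      ∀ m' < m, j + (m' + 1 : ℕ) ∉ A ∧ j + (m' + 1 : ℕ) ∉ C := by
  classical
  have h : ∃ m : ℕ, j + (m + 1 : ℕ) ∈ A ∨ j + (m + 1 : ℕ) ∈ C := by
    obtain ⟨a, ha⟩ := hA
    exact ⟨(a - j - 1).val, Or.inl (by simpa using ha)⟩
  exact ⟨Nat.find h, Nat.find_spec h, fun m' hm' => not_or.1 (Nat.find_min h hm')⟩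

lemma exists_prev (hA : A.Nonempty) (C : Finset (ZMod n)) (i : ZMod n) :
    ∃ l : ℕ, (i - (l + 1 : ℕ) ∈ A ∨ i - (l + 1 : ℕ) ∈ C) ∧
      ∀ m < l, i - (m + 1 : ℕ) ∉ A ∧ i - (m + 1 : ℕ) ∉ C := by
  classical
  have h : ∃ l : ℕ, i - (l + 1 : ℕ) ∈ A ∨ i - (l + 1 : ℕ) ∈ C := by
    obtain ⟨a, ha⟩ := hA
    exact ⟨(i - a - 1).val, Or.inl (by simpa using ha)⟩
  exact ⟨Nat.find h, Nat.find_spec h, fun m' hm' => not_or.1 (Nat.find_min h hm')⟩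

lemma evalValleys_injective (hA : A.Nonempty) : Function.Injective (evalValleys A C) := by
  rw [← LinearMap.ker_eq_bot, LinearMap.ker_eq_bot']
  rintro ⟨h, hh⟩ h0
  have h0 (i : ZMod n) (hi : i ∈ valleys A C) : h (i - 1) = 0 := congrFun h0 ⟨i, hi⟩
  refine Subtype.ext (funext fun j => ?_)
  change h j = 0
  obtain ⟨m, hm, hm'⟩ := exists_next hA C j
  rw [← flatSections_const_right hh j m hm']
  have e : j + (m : ZMod n) = j + (m + 1 : ℕ) - 1 := by push_cast; ring
  rcases hm with hm | hm
  · rw [e]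
    generalize j + ((m + 1 : ℕ) : ZMod n) = i at hm
    obtain ⟨l, hl, hl'⟩ := exists_prev hA C i
    rcases hl with hl | hl
    · have e : i - 1 = i - (l + 1 : ℕ) + (l : ℕ) := by push_cast; ring
      rw [e, flatSections_const_right hh _ l]
      · exact (hh _).1 hl
      · intro m' hm'
        obtain ⟨q, rfl⟩ : ∃ q, l = m' + 1 + q := ⟨l - m' - 1, by omega⟩
        have e : i - (m' + 1 + q + 1 : ℕ) + (m' + 1 : ℕ) = i - ((q + 1 : ℕ) : ZMod n) := by
          push_cast
          ring
        rw [e]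
        exact hl' q (by omega)
    · exact h0 i (mem_valleys.2 ⟨l, hm, hl, fun m h => (hl' m h).1, fun m h => (hl' m h).2⟩)
  · rw [e]
    exact (hh _).2.1 hm

lemma finrank_flatSections (hAC : Disjoint A C) (hA : A.Nonempty) :
    Module.finrank ℂ (flatSections A C) = (valleys A C).card := by
  rw [(LinearEquiv.ofBijective _
    ⟨evalValleys_injective hA, evalValleys_surjective hAC⟩).finrank_eq, Module.finrank_pi,
    Fintype.card_coe]

lemma finrank_flatSections_empty :
    Module.finrank ℂ (flatSections (∅ : Finset (ZMod n)) ∅) ≤ 1 := by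
  have : Function.Injective ((LinearMap.proj 0 : (ZMod n → ℂ) →ₗ[ℂ] ℂ) ∘ₗ
      (flatSections (∅ : Finset (ZMod n)) ∅).subtype) := by
    rw [← LinearMap.ker_eq_bot, LinearMap.ker_eq_bot']
    rintro ⟨h, hh⟩ h0
    refine Subtype.ext (funext fun j => ?_)
    have h1 := flatSections_const_right hh 0 j.val (by simp)
    rw [ZMod.natCast_zmod_val, zero_add] at h1
    exact h1.trans h0
  simpa using LinearMap.finrank_le_finrank_of_injective this

end Valley

namespace RankOne

open Abelian

variable {hk : 0 < k} {hkn : k < n} {I J : Rim k n}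

lemma finite_ext (h3 : (I.1 \ J.1).card ≤ 3) : Module.Finite ℂ (Ext1 hk hkn I J) :=
  Module.Finite.of_surjective _ (extOfFlat_surjective h3)

lemma finrank_ext_add_one (h3 : (I.1 \ J.1).card ≤ 3) :
    Module.finrank ℂ (Ext1 hk hkn I J) + 1 =
      Module.finrank ℂ (flatSections (I.1 \ J.1) (J.1 \ I.1)) := by
  obtain ⟨p, hp⟩ := exists_lowest (I.1 \ J.1) (J.1 \ I.1)
  set w := height (I.1 \ J.1) (J.1 \ I.1) with hw
  have hχ : (fun i => if w i = w p then (1 : ℂ) else 0) ∈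
      flatSections (I.1 \ J.1) (J.1 \ I.1) := by
    have h1 := (mem_flatSections_iff (I.disjoint_sdiff_sdiff J)
      (fun i => PowerSeries.X ^ (w i - w p).toNat)).2 fun i => by
        rw [edgeDefect_X_pow (I.disjoint_sdiff_sdiff J) (I.card_sdiff_eq J) hp]
        exact dvd_zero _
    convert h1 using 2 with i
    have := hp i
    split_ifs with hi
    · simp [hi]
    · have : (w i - w p).toNat ≠ 0 := by omega
      simp [this]
  have hker : LinearMap.ker (extOfFlat hk hkn I J) = Submodule.span ℂ {⟨_, hχ⟩} := by
    ext h
    rw [LinearMap.mem_ker, extOfFlat_eq_zero_iff h3 hp, Submodule.mem_span_singleton]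
    constructor
    · intro h1
      refine ⟨h.1 p, Subtype.ext (funext fun i => ?_)⟩
      rw [h1 i]
      change h.1 p * (if w i = w p then (1 : ℂ) else 0) = _
      rw [mul_ite, mul_one, mul_zero]
    · rintro ⟨c, rfl⟩ i
      change c * (if w i = w p then (1 : ℂ) else 0) =
        if w i = w p then c * (if w p = w p then (1 : ℂ) else 0) else 0
      rw [mul_ite, if_pos rfl, mul_one, mul_zero]
  have hne : (⟨_, hχ⟩ : flatSections (I.1 \ J.1) (J.1 \ I.1)) ≠ 0 := by
    intro h
    have := congrFun (congrArg Subtype.val h) p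
    simp at this
  rw [← LinearMap.finrank_range_add_finrank_ker (extOfFlat hk hkn I J), hker,
    finrank_span_singleton hne, LinearMap.range_eq_top.2 (extOfFlat_surjective h3), finrank_top]

end RankOne

/-! ### The cyclic order -/

section Cyclic

lemma sbtw_iff_val (a b c : ZMod n) : sbtw a b c ↔
    a.val < b.val ∧ b.val < c.val ∨ b.val < c.val ∧ c.val < a.val ∨
      c.val < a.val ∧ a.val < b.val := by
  obtain ⟨m, rfl⟩ : ∃ m, n = m + 1 := Nat.exists_eq_succ_of_ne_zero (NeZero.ne n)
  exact Fin.sbtw_iff (n := m + 1)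

lemma val_sub_eq (a b : ZMod n) :
    (b - a).val = if a.val ≤ b.val then b.val - a.val else n + b.val - a.val := by
  split_ifs with h
  · exact ZMod.val_sub h
  · have ha := ZMod.val_lt a
    have h1 : b - a = ((n + b.val - a.val : ℕ) : ZMod n) := by
      rw [Nat.cast_sub (by omega)]
      simp
    rw [h1, ZMod.val_natCast, Nat.mod_eq_of_lt (by omega)]

/-- The cyclic order in terms of the distances from the first point. -/
lemma sbtw_iff_val_sub (a b c : ZMod n) :
    sbtw a b c ↔ 0 < (b - a).val ∧ (b - a).val < (c - a).val := by
  have := ZMod.val_lt a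
  have := ZMod.val_lt b
  have := ZMod.val_lt c
  rw [sbtw_iff_val, val_sub_eq, val_sub_eq]
  split_ifs <;> omega

lemma sbtw_add_natCast (x : ZMod n) {p q r : ℕ} (hpq : p < q) (hqr : q < r) (hr : r < n) :
    sbtw (x + p) (x + q) (x + r) := by
  have h {s : ℕ} (h : p < s) (hs : s < n) : (x + s - (x + p)).val = s - p := by
    have e : x + s - (x + p) = ((s - p : ℕ) : ZMod n) := by
      rw [Nat.cast_sub h.le]; ring
    rw [e, ZMod.val_natCast, Nat.mod_eq_of_lt (by omega)]
  rw [sbtw_iff_val_sub, h hpq (by omega), h (by omega) hr]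
  omega

lemma cyclicallyOrdered_of_strictMono {r : ℕ} (x : ZMod n) {P : Fin r → ℕ} (hP : StrictMono P)
    (hn : ∀ j, P j < n) : CyclicallyOrdered fun j => x + (P j : ZMod n) :=
  fun _ _ l hij hjl => sbtw_add_natCast x (hP hij) (hP hjl) (hn l)

variable {A C : Finset (ZMod n)}

/-- The first element of `A` after an element of `C` ends a valley. -/
lemma exists_valley_after (hAC : Disjoint A C) (hA : A.Nonempty) {c : ZMod n} (hc : c ∈ C) :
    ∃ m : ℕ, c + (m + 1 : ℕ) ∈ valleys A C ∧ ∀ m' < m, c + (m' + 1 : ℕ) ∉ A := by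
  classical
  have h : ∃ m : ℕ, c + (m + 1 : ℕ) ∈ A := by
    obtain ⟨a, ha⟩ := hA
    exact ⟨(a - c - 1).val, by simpa using ha⟩
  refine ⟨Nat.find h, ?_, fun m' hm' => Nat.find_min h hm'⟩
  obtain ⟨l, hl, hl'⟩ := exists_prev hA C (c + (Nat.find h + 1 : ℕ))
  refine mem_valleys.2 ⟨l, Nat.find_spec h, hl.resolve_left fun hlA => ?_,
    fun m hm => (hl' m hm).1, fun m hm => (hl' m hm).2⟩
  rcases Nat.lt_or_ge (Nat.find h) l with h1 | h1
  · exact (hl' _ h1).2 (by simpa using hc)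
  · rcases h1.eq_or_lt with h1 | h1
    · rw [h1, add_sub_cancel_right] at hlA
      exact Finset.disjoint_left.1 hAC hlA hc
    · refine Nat.find_min h (m := Nat.find h - l - 1) (by omega) ?_
      have e : c + ((Nat.find h - l - 1 + 1 : ℕ) : ZMod n) =
          c + (Nat.find h + 1 : ℕ) - (l + 1 : ℕ) := by
        have : Nat.find h = Nat.find h - l - 1 + 1 + l := by omega
        conv_rhs => rw [this]
        push_cast
        ring
      rw [e]
      exact hlA

/-- If any two elements of a family in `C` are separated by elements of `A`, then there are
at least as many valleys. -/
lemma card_le_card_valleys (hAC : Disjoint A C) (hA : A.Nonempty) {r : ℕ} (c : Fin r → ZMod n) (hc : ∀ j, c j ∈ C)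
    (hsep : ∀ j j', j ≠ j' → ∃ a ∈ A, sbtw (c j) a (c j')) : r ≤ (valleys A C).card := by
  choose m hm hm' using fun j => exists_valley_after hAC hA (hc j)
  have key (j j' : Fin r) (hj : j ≠ j') (e : c j + (m j + 1 : ℕ) = c j' + (m j' + 1 : ℕ)) :
      m j < m j' := by
    by_contra! hle
    obtain ⟨a, ha, hs⟩ := hsep j j' hj
    rw [sbtw_iff_val_sub] at hs
    have e1 : c j' - c j = ((m j - m j' : ℕ) : ZMod n) := by
      rw [Nat.cast_sub hle]
      push_cast at e
      linear_combination -e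
    have h1 : (c j' - c j).val ≤ m j - m j' := by
      rw [e1, ZMod.val_natCast]; exact Nat.mod_le _ _
    refine hm' j ((a - c j).val - 1) (by omega) ?_
    rw [Nat.sub_add_cancel hs.1, ZMod.natCast_zmod_val, add_sub_cancel]
    exact ha
  have hinj : Function.Injective fun j => c j + ((m j + 1 : ℕ) : ZMod n) := by
    intro j j' e
    by_contra hj
    exact lt_asymm (key j j' hj e) (key j' j (Ne.symm hj) e.symm)
  calc r = (Finset.univ.image fun j => c j + ((m j + 1 : ℕ) : ZMod n)).card := by
        rw [Finset.card_image_of_injective _ hinj, Finset.card_univ, Fintype.card_fin]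
    _ ≤ (valleys A C).card := Finset.card_le_card fun i hi => by
        obtain ⟨j, -, rfl⟩ := Finset.mem_image.1 hi
        exact hm j

lemma EndsValley.lt_of_sub_mem (hAC : Disjoint A C) {i : ZMod n} {l : ℕ} (h : EndsValley A C i l)
    {d : ℕ} (hd : 0 < d) (hi : i - (d : ZMod n) ∈ A) : l + 1 < d := by
  by_contra! hle
  refine h.notMem_of_le hAC (m := d - 1) (by omega) ?_
  rwa [Nat.sub_add_cancel hd]

end Cyclic

section Interlacing

variable {I J : Rim k n}

lemma le_card_valleys_of_hasAlternating {r : ℕ} (hr : 0 < r) (h : HasAlternating r I J) :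
    r ≤ (valleys (I.1 \ J.1) (J.1 \ I.1)).card := by
  obtain ⟨a, ha, hmem⟩ := h
  have h0 : a ⟨0, by omega⟩ ∈ I.1 \ J.1 := (hmem _).1 (by simp)
  refine card_le_card_valleys (I.disjoint_sdiff_sdiff J) ⟨_, h0⟩ (fun j : Fin r => a ⟨2 * j.1 + 1, by omega⟩)
    (fun j => (hmem _).2 (by simp)) fun j j' hj => ?_
  rcases lt_or_gt_of_ne hj with hj | hj
  · refine ⟨a ⟨2 * j.1 + 2, by omega⟩, (hmem _).1 (by simp [parity_simps]), ha _ _ _ ?_ ?_⟩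
    · exact Fin.mk_lt_mk.2 (by omega)
    · exact Fin.mk_lt_mk.2 (by omega)
  · refine ⟨_, h0, SBtw.sbtw.cyclic_right (ha _ _ _ ?_ ?_)⟩
    · exact Fin.mk_lt_mk.2 (by omega)
    · exact Fin.mk_lt_mk.2 (by omega)

lemma hasAlternating_of_endsValley {x y z : ZMod n} {l₀ l₁ l₂ : ℕ}
    (hx : EndsValley (I.1 \ J.1) (J.1 \ I.1) x l₀) (hy : EndsValley (I.1 \ J.1) (J.1 \ I.1) y l₁)
    (hz : EndsValley (I.1 \ J.1) (J.1 \ I.1) z l₂) (h : sbtw x y z) : HasAlternating 3 I J := by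
  rw [sbtw_iff_val_sub] at h
  have hn := ZMod.val_lt (z - x)
  obtain ⟨d, hd⟩ : ∃ d, d = (y - x).val := ⟨_, rfl⟩
  obtain ⟨d', hd'⟩ : ∃ d, d = (z - x).val := ⟨_, rfl⟩
  rw [← hd, ← hd'] at h
  rw [← hd'] at hn
  have ey : y = x + (d : ZMod n) := by rw [hd, ZMod.natCast_zmod_val]; ring
  have ez : z = x + (d' : ZMod n) := by rw [hd', ZMod.natCast_zmod_val]; ring
  have hAC := I.disjoint_sdiff_sdiff J
  have h1 : l₁ + 1 < d := hy.lt_of_sub_mem hAC h.1 (by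
    rw [ey, add_sub_cancel_right]; exact hx.mem)
  have h2 : l₂ + 1 < d' - d := hz.lt_of_sub_mem hAC (by omega) (by
    have e : z - ((d' - d : ℕ) : ZMod n) = y := by rw [Nat.cast_sub h.2.le, ez, ey]; ring
    rw [e]
    exact hy.mem)
  have h0 : l₀ + 1 < n - d' := hx.lt_of_sub_mem hAC (by omega) (by
    rw [Nat.cast_sub hn.le, ZMod.natCast_self, zero_sub, sub_neg_eq_add, ← ez]; exact hz.mem)
  have m1 := hy.mem_start
  have m2 := hz.mem_start
  have m0 := hx.mem_start
  rw [ey, add_sub_assoc, ← Nat.cast_sub h1.le] at m1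
  rw [ez, add_sub_assoc, ← Nat.cast_sub (by omega)] at m2
  rw [← add_zero x, add_sub_assoc, ← ZMod.natCast_self n, ← Nat.cast_sub (by omega)] at m0
  have n1 := hy.mem
  have n2 := hz.mem
  rw [ey] at n1
  rw [ez] at n2
  let P : Fin (2 * 3) → ℕ := ![0, d - (l₁ + 1), d, d' - (l₂ + 1), d', n - (l₀ + 1)]
  have hP : StrictMono P := by
    refine Fin.strictMono_iff_lt_succ.2 fun j => ?_
    fin_cases j <;> simp [P] <;> omega
  refine ⟨_, cyclicallyOrdered_of_strictMono x hP fun j => ?_, fun j => ?_⟩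
  · fin_cases j <;> simp [P] <;> omega
  · fin_cases j
    · exact ⟨fun _ => by simpa [P] using hx.mem, fun h => absurd h (by decide)⟩
    · exact ⟨fun h => absurd h (by decide), fun _ => m1⟩
    · exact ⟨fun _ => n1, fun h => absurd h (by decide)⟩
    · exact ⟨fun h => absurd h (by decide), fun _ => m2⟩
    · exact ⟨fun _ => n2, fun h => absurd h (by decide)⟩
    · exact ⟨fun h => absurd h (by decide), fun _ => m0⟩

lemma sbtw_or_sbtw {x y z : ZMod n} (hxy : x ≠ y) (hxz : x ≠ z) (hyz : y ≠ z) :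
    sbtw x y z ∨ sbtw x z y := by
  rw [sbtw_iff_val_sub, sbtw_iff_val_sub]
  have h1 : (y - x).val ≠ 0 := by rw [Ne, ZMod.val_eq_zero, sub_eq_zero]; exact hxy.symm
  have h2 : (z - x).val ≠ 0 := by rw [Ne, ZMod.val_eq_zero, sub_eq_zero]; exact hxz.symm
  have h3 : (y - x).val ≠ (z - x).val := fun h => hyz (sub_left_injective (ZMod.val_injective n h))
  omega

lemma interlacing_iff_card_valleys {I J : Rim 3 n} :
    Interlacing 3 I J ↔ (valleys (I.1 \ J.1) (J.1 \ I.1)).card = 3 := by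
  have hle : (valleys (I.1 \ J.1) (J.1 \ I.1)).card ≤ 3 :=
    (Finset.card_le_card valleys_subset).trans (I.card_sdiff_le J)
  constructor
  · intro h
    exact le_antisymm hle (le_card_valleys_of_hasAlternating (by omega) h.1)
  · intro h
    refine ⟨?_, fun s hs h' => ?_⟩
    · obtain ⟨x, y, z, hxy, hxz, hyz, e⟩ := Finset.card_eq_three.1 h
      obtain ⟨lx, hx⟩ := mem_valleys.1 (by rw [e]; simp : x ∈ valleys (I.1 \ J.1) (J.1 \ I.1))
      obtain ⟨ly, hy⟩ := mem_valleys.1 (by rw [e]; simp : y ∈ valleys (I.1 \ J.1) (J.1 \ I.1))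
      obtain ⟨lz, hz⟩ := mem_valleys.1 (by rw [e]; simp : z ∈ valleys (I.1 \ J.1) (J.1 \ I.1))
      rcases sbtw_or_sbtw hxy hxz hyz with hs | hs
      · exact hasAlternating_of_endsValley hx hy hz hs
      · exact hasAlternating_of_endsValley hx hz hy hs
    · have := le_card_valleys_of_hasAlternating (by omega) h'
      omega

lemma Crossing.hasAlternating (h : Crossing I J) : HasAlternating 2 I J := by
  obtain ⟨a, b, c, d, h, ha, hc, hb, hd⟩ := h
  refine ⟨![a, b, c, d], h, fun j => ?_⟩
  fin_cases j
  · exact ⟨fun _ => ha, fun h => absurd h (by decide)⟩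
  · exact ⟨fun h => absurd h (by decide), fun _ => hb⟩
  · exact ⟨fun _ => hc, fun h => absurd h (by decide)⟩
  · exact ⟨fun h => absurd h (by decide), fun _ => hd⟩

end Interlacing

section Residual

/-- Modules over `ℂ` and `ℂ⟦t⟧` on which power series act through their constant coefficients. -/
def ActsByConstantCoeff (E : Type*) [AddCommGroup E] [Module ℂ E] [Module ℂ⟦X⟧ E] : Prop :=
  ∀ (f : ℂ⟦X⟧) (e : E), f • e = PowerSeries.constantCoeff f • e

lemma exists_eq_C_add_X_mul (f : ℂ⟦X⟧) :
    ∃ g, f = PowerSeries.C (PowerSeries.constantCoeff f) + PowerSeries.X * g := by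
  obtain ⟨g, hg⟩ := PowerSeries.X_dvd_iff.2
    (by rw [map_sub, PowerSeries.constantCoeff_C, sub_self] :
      PowerSeries.constantCoeff (f - PowerSeries.C (PowerSeries.constantCoeff f)) = 0)
  exact ⟨g, by rw [← hg]; ring⟩

lemma nonempty_linearEquiv_iff {E F : Type*} [AddCommGroup E] [Module ℂ E] [Module ℂ⟦X⟧ E]
    [AddCommGroup F] [Module ℂ F] [Module ℂ⟦X⟧ F] (hE : ActsByConstantCoeff E)
    (hF : ActsByConstantCoeff F) : Nonempty (E ≃ₗ[ℂ⟦X⟧] F) ↔ Nonempty (E ≃ₗ[ℂ] F) := by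
  constructor
  · rintro ⟨φ⟩
    refine ⟨{ φ.toAddEquiv with map_smul' := fun c e => ?_ }⟩
    have h := φ.map_smul (PowerSeries.C c) e
    rw [hE, hF, PowerSeries.constantCoeff_C] at h
    exact h
  · rintro ⟨φ⟩
    refine ⟨{ φ.toAddEquiv with map_smul' := fun f e => ?_ }⟩
    have h := φ.map_smul (PowerSeries.constantCoeff f) e
    rw [← hE, ← hF] at h
    exact h

lemma actsByConstantCoeff_residueField : ActsByConstantCoeff ResidueField := by
  intro f e
  obtain ⟨g, rfl⟩ := Ideal.Quotient.mk_surjective e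
  refine (Ideal.Quotient.eq (x := f * g)
    (y := PowerSeries.constantCoeff f • g)).2 (Ideal.mem_span_singleton.2 ?_)
  rw [PowerSeries.X_dvd_iff, PowerSeries.smul_eq_C_mul, map_sub, map_mul, map_mul,
    PowerSeries.constantCoeff_C, sub_self]

lemma finrank_residueField : Module.finrank ℂ ResidueField = 1 := by
  refine finrank_eq_one_iff'.2 ⟨Ideal.Quotient.mk _ 1, ?_, fun e => ?_⟩
  · rw [Ne, Ideal.Quotient.eq_zero_iff_mem, Ideal.mem_span_singleton, PowerSeries.X_dvd_iff,
      map_one]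
    exact one_ne_zero
  · obtain ⟨g, rfl⟩ := Ideal.Quotient.mk_surjective e
    refine ⟨PowerSeries.constantCoeff g, (actsByConstantCoeff_residueField g _).symm.trans ?_⟩
    exact congrArg (Ideal.Quotient.mk _) (mul_one g)

lemma actsByConstantCoeff_prod {E F : Type*} [AddCommGroup E] [Module ℂ E] [Module ℂ⟦X⟧ E]
    [AddCommGroup F] [Module ℂ F] [Module ℂ⟦X⟧ F] (hE : ActsByConstantCoeff E)
    (hF : ActsByConstantCoeff F) : ActsByConstantCoeff (E × F) :=
  fun f e => Prod.ext (hE f e.1) (hF f e.2)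

end Residual

namespace RankOne

open Abelian

variable {hk : 0 < k} {hkn : k < n} {I J : Rim k n}

lemma C_smul_ext (c : ℂ) (e : Ext1 hk hkn I J) : PowerSeries.C c • e = c • e := by
  have h : (PowerSeries.C c • 𝟙 (obj hk hkn J) : obj hk hkn J ⟶ obj hk hkn J) =
      c • 𝟙 (obj hk hkn J) := by
    refine ModuleCat.hom_ext (LinearMap.ext fun u => ?_)
    change algebraMap ℂ⟦X⟧ (B k n) (PowerSeries.C c) • u = algebraMap ℂ (B k n) c • u
    rw [B.algebraMap_C]
  rw [Ext.smul_eq_comp_mk₀, Ext.smul_eq_comp_mk₀, h]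

lemma actsByConstantCoeff_ext (h3 : (I.1 \ J.1).card ≤ 3) :
    ActsByConstantCoeff (Ext1 hk hkn I J) := by
  intro f e
  obtain ⟨g, hg⟩ := exists_eq_C_add_X_mul f
  conv_lhs => rw [hg]
  rw [add_smul, mul_smul, X_smul_ext_eq_zero h3, add_zero, C_smul_ext]

end RankOne

section Main

variable {hk : 0 < 3} {hkn : 3 < n} {I J : Rim 3 n}

lemma finrank_ext_add_one_eq (h : (I.1 \ J.1).Nonempty) :
    Module.finrank ℂ (Ext1 hk hkn I J) + 1 = (valleys (I.1 \ J.1) (J.1 \ I.1)).card := by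
  rw [RankOne.finrank_ext_add_one (I.card_sdiff_le J),
    finrank_flatSections (I.disjoint_sdiff_sdiff J) h]

lemma finrank_ext_eq_two_iff : Module.finrank ℂ (Ext1 hk hkn I J) = 2 ↔ Interlacing 3 I J := by
  rw [interlacing_iff_card_valleys]
  rcases (I.1 \ J.1).eq_empty_or_nonempty with h | h
  · have h' : J.1 \ I.1 = ∅ := by rw [← Finset.card_eq_zero, ← I.card_sdiff_eq J, h]; rfl
    have h1 := RankOne.finrank_ext_add_one (hk := hk) (hkn := hkn) (I.card_sdiff_le J)
    have h2 : (valleys (I.1 \ J.1) (J.1 \ I.1)).card ≤ (I.1 \ J.1).card :=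
      Finset.card_le_card valleys_subset
    rw [h, h'] at h1
    have h3 := finrank_flatSections_empty (n := n)
    rw [h, Finset.card_empty] at h2
    rw [h]
    omega
  · have := finrank_ext_add_one_eq (hk := hk) (hkn := hkn) h
    omega

lemma finrank_ext_eq_one (hc : Crossing I J) (hi : ¬ Interlacing 3 I J) :
    Module.finrank ℂ (Ext1 hk hkn I J) = 1 := by
  have h2 := le_card_valleys_of_hasAlternating (by omega) hc.hasAlternating
  have h : (I.1 \ J.1).Nonempty := by
    obtain ⟨a, _, _, _, _, ha, _⟩ := hc
    exact ⟨a, ha⟩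
  have h1 := finrank_ext_add_one_eq (hk := hk) (hkn := hkn) h
  have h3 : (valleys (I.1 \ J.1) (J.1 \ I.1)).card ≤ 3 :=
    (Finset.card_le_card valleys_subset).trans (I.card_sdiff_le J)
  rw [interlacing_iff_card_valleys] at hi
  omega

end Main

end BoundaryAlgebra

end
open BoundaryAlgebra in
theorem corollary5p1 (n : ℕ) [NeZero n] (hn : 6 ≤ n) (I J : Rim 3 n) :
    (Nonempty (Ext1 (k := 3) (by omega) (by omega) I J ≃ₗ[ℂ] ℂ × ℂ) ↔ Interlacing 3 I J) ∧
    (Nonempty (Ext1 (k := 3) (by omega) (by omega) I J ≃ₗ[ℂ⟦X⟧] ResidueField × ResidueField) ↔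
      Interlacing 3 I J) ∧
    (Crossing I J → ¬ Interlacing 3 I J →
      Nonempty (Ext1 (k := 3) (by omega) (by omega) I J ≃ₗ[ℂ] ℂ) ∧
      Nonempty (Ext1 (k := 3) (by omega) (by omega) I J ≃ₗ[ℂ⟦X⟧] ResidueField)) := by
  have hk : 0 < 3 := by omega
  have hkn : 3 < n := by omega
  have hE := RankOne.actsByConstantCoeff_ext (hk := hk) (hkn := hkn) (I.card_sdiff_le J)
  have hfin : Module.Finite ℂ (Ext1 hk hkn I J) := RankOne.finite_ext (I.card_sdiff_le J)
  have hR : Module.Finite ℂ ResidueField :=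
    Module.finite_of_finrank_eq_succ finrank_residueField
  have h1 := finrank_ext_eq_two_iff (hk := hk) (hkn := hkn) (I := I) (J := J)
  refine ⟨?_, ?_, fun hc hi => ⟨?_, ?_⟩⟩
  · refine (FiniteDimensional.nonempty_linearEquiv_iff_finrank_eq (M := Ext1 hk hkn I J)).trans ?_
    rw [Module.finrank_prod, Module.finrank_self]
    exact h1
  · refine (nonempty_linearEquiv_iff hE (actsByConstantCoeff_prod actsByConstantCoeff_residueField
      actsByConstantCoeff_residueField)).trans ?_
    refine (FiniteDimensional.nonempty_linearEquiv_iff_finrank_eq (M := Ext1 hk hkn I J)).trans ?_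
    rw [Module.finrank_prod, finrank_residueField]
    exact h1
  · refine (FiniteDimensional.nonempty_linearEquiv_iff_finrank_eq (M := Ext1 hk hkn I J)).2 ?_
    rw [Module.finrank_self]
    exact finrank_ext_eq_one hc hi
  · refine (nonempty_linearEquiv_iff hE actsByConstantCoeff_residueField).2 ?_
    refine (FiniteDimensional.nonempty_linearEquiv_iff_finrank_eq (M := Ext1 hk hkn I J)).2 ?_
    rw [finrank_residueField]
    exact finrank_ext_eq_one hc hi
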